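/- **Setting.** Consider $N$ fog nodes. Node $j$ has workload arrival rate $\lambda_j>0$, service rate $\mu_j>0$, and round-trip time $\tau^u_j$ to its users; $\tau_{ji}$ is the forwarding round-trip time between nodes $j$ and $i$, and $\tau^c$ the round-trip time to the cloud. Node $j$ has power usage effectiveness $e_j>0$, static power $w^S_j\ge 0$, dynamic power $w^D_j$ per unit of workload, and a power efficiency bound $\bar\eta_j>e_jw^D_j$; put $\chi_j=\dfrac{w^S_je_j}{\bar\eta_j-e_jw^D_j}$. For $\phi=(\phi_{ji})\in\mathbb R^{N\times N}$, where $\phi_{ji}$ is the workload of node $j$ processed by node $i$, the response time of node $j$ is $$R^C_j(\phi)=\tau^u_j+\frac1{\sum_i\lambda_i}\sum_{i}\phi_{ji}\Big(\tau_{ji}+\frac1{\mu_i-\sum_k\phi_{ki}}\Big)+\Big(1-\sum_i\frac{\phi_{ji}}{\lambda_j}\Big)\tau^c .$$ Let $\phi_{\bullet i}=(\phi_{ji})_j$ and $$\mathcal G_i=\Big\{v\in\mathbb R^N:\ 0\le v_k\le\lambda_k\ \forall k,\ \sum_kv_k\le\chi_i,\ \sum_kv_k<\mu_i\Big\},\qquad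 \mathcal G_c=\Big\{\psi\in\mathbb R^{N\times N}:\ \sum_i\psi_{ji}\le\lambda_j\ \forall j\Big\}.$$ The cooperative workload allocation problem is to minimize $F(\phi)=\sum_jR^C_j(\phi)$ subject to $\phi_{\bullet i}\in\mathcal G_i$ for all $i$ and $\phi\in\mathcal G_c$. The objective is separable, $F(\phi)=\sum_iS_i(\phi_{\bullet i})$ with $$S_i(v)=\tau^u_i+\frac1{\sum_j\lambda_j}\sum_jv_j\Big(\tau_{ji}+\frac1{\mu_i-\sum_kv_k}\Big)+\Big(1-\sum_j\frac{v_j}{\lambda_j}\Big)\tau^c .$$ **Algorithm (distributed ADMM-VS).** Fix $\rho>0$ and arbitrary initial $\phi^0,\psi^0,\Lambda^0\in\mathbb R^{N\times N}$. For $t=0,1,2,\dots$: 1. each node $i$ computes $\phi^{t+1}_{\bullet i}\in\arg\min_{v\in\mathcal G_i}\big\{S_i(v)+\tfrac\rho2\|v-\psi^t_{\bullet i}+\Lambda^t_{\bullet i}\|_2^2\big\}$; 2. the coordinator computes the projection $\psi^{t+1}\in\arg\min_{\psi\in\mathcal G_c}\tfrac\rho2\|\phi^{t+1}-\psi+\Lambda^t\|_2^2$;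 3. $\Lambda^{t+1}=\Lambda^t+(\phi^{t+1}-\psi^{t+1})$. **Theorem 2.** Every initialization determines exactly one sequence of iterates, and for every such sequence there is a global optimal solution $\phi^*$ of the cooperative workload allocation problem such that $\phi^t\to\phi^*$ and $\psi^t\to\phi^*$ as $t\to\infty$, with convergence rate $O(1/t)$: $\ \|\phi^t-\phi^*\|=O(1/t)$ and $|F(\phi^t)-F(\phi^*)|=O(1/t)$. -/

import Mathlib

open Filter Topology Asymptotics

/-- A fog computing network with `N` cooperating fog nodes and a remote cloud. -/
structure FogSystem (N : ℕ) where
  /-- workload arrival rate `λ_j` at node `j` -/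
  arr : Fin N → ℝ
  /-- maximum amount of workload `μ_i` that node `i` can process (service rate) -/
  mu : Fin N → ℝ
  /-- round-trip time `τᵘ_j` between node `j` and its users -/
  tauU : Fin N → ℝ
  /-- round-trip workload forwarding time `τ_{ji}` between nodes `j` and `i` -/
  tau : Fin N → Fin N → ℝ
  /-- round-trip time `τᶜ` to the cloud -/
  tauC : ℝ
  /-- power usage effectiveness `e_i` -/
  pue : Fin N → ℝ
  /-- static power consumption `wˢ_i` -/
  wS : Fin N → ℝ
  /-- dynamic power consumption `wᴰ_i` per unit of workload -/
  wD : Fin N → ℝ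
  /-- power efficiency bound `η̄_i` -/
  etaBar : Fin N → ℝ
  arr_pos : ∀ j, 0 < arr j
  mu_pos : ∀ i, 0 < mu i
  pue_pos : ∀ i, 0 < pue i
  wS_nonneg : ∀ i, 0 ≤ wS i
  etaBar_gt : ∀ i, pue i * wD i < etaBar i

/-- A workload processing matrix: `x j i` is the amount `φ_{ji}` of the workload of node `j` that is
processed by node `i`. The row `x j` is the request vector of node `j`; the column
`fun j => x j i` is the service vector of node `i`. -/
abbrev Alloc (N : ℕ) : Type := Fin N → Fin N → ℝ

namespace FogSystem

variable {N : ℕ}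

/-- The maximum amount `χ_i` of workload that node `i` can process under its power efficiency
constraint. -/
noncomputable def chi (P : FogSystem N) (i : Fin N) : ℝ :=
  P.wS i * P.pue i / (P.etaBar i - P.pue i * P.wD i)

/-- The fraction of the workload of node `j` that is forwarded to the cloud. -/
noncomputable def cloudShare (P : FogSystem N) (x : Alloc N) (j : Fin N) : ℝ :=
  1 - ∑ i, x j i / P.arr j

/-- The response time of node `j` under cooperation (M/M/1 queueing delay at every node). -/
noncomputable def responseTime (P : FogSystem N) (x : Alloc N) (j : Fin N) : ℝ :=
  P.tauU j + 1 / (∑ i, P.arr i) * ∑ i, x j i * (P.tau j i + 1 / (P.mu i - ∑ k, x k i))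
    + P.cloudShare x j * P.tauC

/-- The objective: the sum of the response times of all nodes. -/
noncomputable def totalResponse (P : FogSystem N) (x : Alloc N) : ℝ :=
  ∑ j, P.responseTime x j

/-- `G_i`: the admissible service vectors of node `i`. The strict inequality is the stability of the
queue at node `i`, outside of which the response time is infinite. -/
def nodeSet (P : FogSystem N) (i : Fin N) : Set (Fin N → ℝ) :=
  {v | (∀ k, 0 ≤ v k ∧ v k ≤ P.arr k) ∧ ∑ k, v k ≤ P.chi i ∧ ∑ k, v k < P.mu i}

/-- `G_c`: the coupling constraint that no node hands out more workload than it receives; the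
remainder goes to the cloud. -/
def couplingSet (P : FogSystem N) : Set (Alloc N) :=
  {x | ∀ j, ∑ i, x j i ≤ P.arr j}

/-- The feasible set of the cooperative workload allocation problem. -/
def feasibleSet (P : FogSystem N) : Set (Alloc N) :=
  {x | (∀ i, (fun j => x j i) ∈ P.nodeSet i) ∧ x ∈ P.couplingSet}

/-- `x` is a global optimal solution of the cooperative workload allocation problem. -/
def IsOptimal (P : FogSystem N) (x : Alloc N) : Prop :=
  x ∈ P.feasibleSet ∧ IsMinOn P.totalResponse P.feasibleSet x

/-- The part of the objective that depends on the service vector `v` of node `i`. -/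
noncomputable def nodeCost (P : FogSystem N) (i : Fin N) (v : Fin N → ℝ) : ℝ :=
  P.tauU i + 1 / (∑ j, P.arr j) * ∑ j, v j * (P.tau j i + 1 / (P.mu i - ∑ k, v k))
    + (1 - ∑ j, v j / P.arr j) * P.tauC

/-- The objective is separable over the service vectors. -/
theorem sum_nodeCost (P : FogSystem N) (x : Alloc N) :
    ∑ i, P.nodeCost i (fun j => x j i) = P.totalResponse x := by
  unfold totalResponse responseTime cloudShare nodeCost
  simp only [Finset.sum_add_distrib, ← Finset.mul_sum, ← Finset.sum_mul, Finset.sum_sub_distrib]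
  rw [Finset.sum_comm (f := fun i j => x j i * (P.tau j i + 1 / (P.mu i - ∑ k, x k i))),
    Finset.sum_comm (f := fun i j => x j i / P.arr j)]

end FogSystem

/-- The variables of the algorithm: the allocation `phi`, its split copy `psi`, and the (scaled)
dual variable `dual`. -/
structure ADMMState (N : ℕ) where
  phi : Alloc N
  psi : Alloc N
  dual : Alloc N

/-- One iteration of the distributed ADMM-VS algorithm with parameter `ρ`, from `z` to `z'`. -/
structure IsADMMStep {N : ℕ} (P : FogSystem N) (ρ : ℝ) (z z' : ADMMState N) : Prop where
  /-- every node `i` minimises its augmented Lagrangian over its own service vectors -/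
  node_update : ∀ i, (fun j => z'.phi j i) ∈ P.nodeSet i ∧
    IsMinOn (fun v : Fin N → ℝ =>
        P.nodeCost i v + ρ / 2 * ∑ j, (v j - z.psi j i + z.dual j i) ^ 2)
      (P.nodeSet i) (fun j => z'.phi j i)
  /-- the coordinator projects onto `G_c` -/
  coordinator_update : z'.psi ∈ P.couplingSet ∧
    IsMinOn (fun y : Alloc N => ρ / 2 * ∑ j, ∑ i, (z'.phi j i - y j i + z.dual j i) ^ 2)
      P.couplingSet z'.psi
  /-- dual update -/
  dual_update : ∀ j i, z'.dual j i = z.dual j i + (z'.phi j i - z'.psi j i)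

/-- A run of the distributed ADMM-VS algorithm. -/
def IsADMMRun {N : ℕ} (P : FogSystem N) (ρ : ℝ) (z : ℕ → ADMMState N) : Prop :=
  ∀ t, IsADMMStep P ρ (z t) (z (t + 1))

/-!
The iterates converge linearly, which is stronger than the rate `O(1/t)`; for general convex
programs ADMM gives no rate for the iterates at all, so the argument rests on the structure of the
problem. The objective is a linear function plus one function of the scalar load `∑ k, x k i` of
each node, strongly convex and smooth on the stability region, and all remaining constraints are
linear. Since the delay blows up at the boundary of the stability region, that constraint is never
active and contributes no multiplier; by Farkas' lemma the optimality conditions of each iteration,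
and of the problem itself, are multiplier systems of polyhedra (`IsPolyhedralNormal`).

Each iteration decreases the squared distance of `(ψ, Λ)` to every saddle point by at least the
squared residuals `‖ψ' - ψ‖²`, `‖Λ' - Λ‖²` plus a multiple of the squared deviation of the loads
from their optimal values (`PolyhedralProgram.IsIter.fejer`). Conversely, once the loads are treated
as given, the conditions for a saddle point are linear for each choice of the active constraints, so
Hoffman's error bound (`hasPolyhedralErrorBound`, proved by Fourier–Motzkin elimination) bounds the
distance to the set of saddle points by those same quantities
(`PolyhedralProgram.exists_saddle_near`). Hence the squared distance to that set contracts by a fixed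
factor, and Fejér monotonicity turns this into linear convergence to a single saddle point
(`PolyhedralProgram.exists_linear_convergence`). The objective is differentiable at the limit, so its
values inherit the rate.

Existence of the iterates follows from compactness of the sublevel sets
(`exists_isMinOn_add_sum_delay`), uniqueness from strong monotonicity of the optimality conditions.
-/

/-! ### Error bounds for systems of linear inequalities -/

/-- A finite system of linear inequalities on `E` has a local error bound: a point violating each
inequality by at most a small `ε` has a solution at distance `O(ε)`. For an infeasible system this
says that small violations are impossible. The violations are measured by a single number, since
only their maximum matters. -/
def HasPolyhedralErrorBound (E : Type*) [NormedAddCommGroup E] [NormedSpace ℝ E] : Prop :=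
  ∀ (C : Type) [Fintype C] (M : C → E →L[ℝ] ℝ) (b : C → ℝ), ∃ K, 0 ≤ K ∧ ∃ η, 0 < η ∧
    ∀ ε, 0 ≤ ε → ε ≤ η → ∀ u, (∀ c, M c u ≤ b c + ε) →
      ∃ v, (∀ c, M c v ≤ b c) ∧ ‖u - v‖ ≤ K * ε

theorem exists_near_mem_Icc_of_finite {ι κ : Type*} [Finite ι] [Finite κ] {l : ι → ℝ} {u : κ → ℝ}
    {t e : ℝ} (he : 0 ≤ e) (hlu : ∀ i j, l i ≤ u j) (hl : ∀ i, l i ≤ t + e)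
    (hu : ∀ j, t - e ≤ u j) :
    ∃ s, (∀ i, l i ≤ s) ∧ (∀ j, s ≤ u j) ∧ |t - s| ≤ e := by
  have hb' : BddAbove (Set.range fun o : Option ι => o.elim (t - e) l) :=
    Set.finite_range _ |>.bddAbove
  refine ⟨⨆ o : Option ι, o.elim (t - e) l, fun i => le_ciSup hb' (some i), fun j => ?_, ?_⟩
  · refine ciSup_le fun o => ?_
    cases o
    · exact hu j
    · exact hlu _ j
  · have h1 : t - e ≤ ⨆ o : Option ι, o.elim (t - e) l := le_ciSup hb' none
    have h2 : ⨆ o : Option ι, o.elim (t - e) l ≤ t + e := by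
      refine ciSup_le fun o => ?_
      cases o
      · simp only [Option.elim]; linarith
      · exact hl _
    rw [abs_le]; constructor <;> linarith

theorem HasPolyhedralErrorBound.of_subsingleton (E : Type*) [NormedAddCommGroup E]
    [NormedSpace ℝ E] [Subsingleton E] : HasPolyhedralErrorBound E := by
  intro C _ M b
  by_cases h : ∀ c, 0 ≤ b c
  · refine ⟨0, le_rfl, 1, one_pos, fun ε _ _ u _ => ⟨0, fun c => by simpa using h c, ?_⟩⟩
    simp [Subsingleton.elim u 0]
  · push Not at h
    obtain ⟨c, hc⟩ := h
    refine ⟨0, le_rfl, -b c / 2, by linarith, fun ε _ hε u hu => ?_⟩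
    have := hu c
    rw [Subsingleton.elim u 0, map_zero] at this
    linarith

/-- Fourier–Motzkin elimination of one real variable: an upper bound `t ≤ …` and a lower bound
`… ≤ t` combine into an inequality in the remaining variables, and the eliminated variable can be
chosen in the resulting nonempty interval close to its old value. -/
theorem HasPolyhedralErrorBound.prod_real {E : Type*} [NormedAddCommGroup E] [NormedSpace ℝ E]
    (h : HasPolyhedralErrorBound E) : HasPolyhedralErrorBound (ℝ × E) := by
  intro C _ M b
  classical
  set A : C → E →L[ℝ] ℝ := fun c => (M c).comp (ContinuousLinearMap.inr ℝ ℝ E) with hA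
  set τ : C → ℝ := fun c => M c (1, 0) with hτ
  have hM : ∀ c t x, M c (t, x) = τ c * t + A c x := by
    intro c t x
    have : ((t, x) : ℝ × E) = t • ((1, 0) : ℝ × E) + (0, x) := by simp
    rw [this, map_add, map_smul]
    simp [hτ, hA, mul_comm]
  set R : ℝ := 1 + ∑ c, |τ c| with hR
  have hτR : ∀ c, |τ c| ≤ ∑ c, |τ c| := fun c =>
    Finset.single_le_sum (f := fun c => |τ c|) (fun _ _ => abs_nonneg _) (Finset.mem_univ c)
  have hR1 : 1 ≤ R := by
    have : 0 ≤ ∑ c, |τ c| := Finset.sum_nonneg fun _ _ => abs_nonneg _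
    linarith
  obtain ⟨K, hK, η, hη, H⟩ := h (C ⊕ ({c // 0 < τ c} × {c // τ c < 0}))
    (Sum.elim (fun c => if τ c = 0 then A c else 0)
      (fun p => (-τ p.2.1) • A p.1.1 + τ p.1.1 • A p.2.1))
    (Sum.elim (fun c => if τ c = 0 then b c else 0)
      (fun p => (-τ p.2.1) * b p.1.1 + τ p.1.1 * b p.2.1))
  set D : ℝ := ∑ c, (1 + ‖A c‖ * (K * (2 * R))) / |τ c| with hD
  have hDt : ∀ c, 0 ≤ (1 + ‖A c‖ * (K * (2 * R))) / |τ c| := fun c => by positivity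
  have hDc : ∀ c, (1 + ‖A c‖ * (K * (2 * R))) / |τ c| ≤ D := fun c =>
    Finset.single_le_sum (f := fun c => (1 + ‖A c‖ * (K * (2 * R))) / |τ c|)
      (fun c _ => hDt c) (Finset.mem_univ c)
  have hD0 : 0 ≤ D := Finset.sum_nonneg fun c _ => hDt c
  refine ⟨max D (K * (2 * R)), le_max_of_le_left hD0, η / (2 * R), by positivity, ?_⟩
  rintro ε hε hεη ⟨t, x⟩ hu
  have hεη' : 2 * R * ε ≤ η := by
    rw [le_div_iff₀ (by positivity)] at hεη; linarith
  obtain ⟨x', hx', hxx'⟩ := H (2 * R * ε) (by positivity) hεη' x (by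
    rintro (c | ⟨⟨p, hp⟩, ⟨n, hn⟩⟩)
    · by_cases hc : τ c = 0
      · have := hu c
        rw [hM, hc] at this
        simp only [Sum.elim_inl, hc, if_true]
        nlinarith
      · simp only [Sum.elim_inl, hc, if_false, zero_apply]
        positivity
    · have h1 := hu p
      have h2 := hu n
      rw [hM] at h1 h2
      have h3 := hτR p
      have h4 := hτR n
      rw [abs_of_pos hp] at h3
      rw [abs_of_neg hn] at h4
      simp only [Sum.elim_inr, add_apply, smul_apply,
        smul_eq_mul]
      have h5 := mul_le_mul_of_nonneg_left h1 (neg_pos.2 hn).le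
      have h6 := mul_le_mul_of_nonneg_left h2 hp.le
      have h7 : (τ p - τ n) * ε ≤ 2 * R * ε := by
        apply mul_le_mul_of_nonneg_right _ hε
        linarith
      nlinarith)
  have hdist : ∀ c, |A c x - A c x'| ≤ ‖A c‖ * (K * (2 * R)) * ε := by
    intro c
    rw [← map_sub, ← Real.norm_eq_abs]
    refine ((A c).le_opNorm _).trans ?_
    calc ‖A c‖ * ‖x - x'‖ ≤ ‖A c‖ * (K * (2 * R * ε)) := by gcongr
      _ = _ := by ring
  have hstep : ∀ c, τ c ≠ 0 → ε + |A c x - A c x'| ≤ |τ c| * (D * ε) := by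
    intro c hc
    have h0 : 0 < |τ c| := abs_pos.2 hc
    have h1 := hDc c
    rw [div_le_iff₀ h0] at h1
    calc ε + |A c x - A c x'| ≤ (1 + ‖A c‖ * (K * (2 * R))) * ε := by
          have := hdist c; linarith
      _ ≤ D * |τ c| * ε := by gcongr
      _ = _ := by ring
  obtain ⟨s, hs1, hs2, hs3⟩ := exists_near_mem_Icc_of_finite
    (ι := {c // τ c < 0}) (κ := {c // 0 < τ c})
    (l := fun n => (b n.1 - A n.1 x') / τ n.1) (u := fun p => (b p.1 - A p.1 x') / τ p.1)
    (t := t) (e := D * ε) (by positivity)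
    (by
      rintro ⟨n, hn⟩ ⟨p, hp⟩
      have := hx' (Sum.inr (⟨p, hp⟩, ⟨n, hn⟩))
      simp only [Sum.elim_inr, add_apply, smul_apply,
        smul_eq_mul] at this
      rw [div_le_iff_of_neg hn, div_mul_eq_mul_div, div_le_iff₀ hp]
      nlinarith)
    (by
      rintro ⟨n, hn⟩
      have h1 := hu n
      have h2 := hstep n hn.ne
      rw [hM] at h1
      rw [abs_of_neg hn] at h2
      rw [div_le_iff_of_neg hn]
      have h3 := neg_abs_le (A n x - A n x')
      nlinarith)
    (by
      rintro ⟨p, hp⟩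
      have h1 := hu p
      have h2 := hstep p hp.ne'
      rw [hM] at h1
      rw [abs_of_pos hp] at h2
      rw [le_div_iff₀ hp]
      have h3 := neg_abs_le (A p x - A p x')
      nlinarith)
  refine ⟨(s, x'), fun c => ?_, ?_⟩
  · rw [hM]
    rcases lt_trichotomy (τ c) 0 with hc | hc | hc
    · have := hs1 ⟨c, hc⟩
      rw [div_le_iff_of_neg hc] at this
      linarith
    · have := hx' (Sum.inl c)
      simp only [Sum.elim_inl, hc, if_true] at this
      rw [hc]; linarith
    · have := hs2 ⟨c, hc⟩
      rw [le_div_iff₀ hc] at this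
      linarith
  · rw [Prod.mk_sub_mk, Prod.norm_def]
    refine max_le ?_ ?_
    · exact hs3.trans (by gcongr; exact le_max_left _ _)
    · calc ‖x - x'‖ ≤ K * (2 * R) * ε := by linarith
        _ ≤ _ := by gcongr; exact le_max_right _ _

theorem HasPolyhedralErrorBound.congr {E F : Type*} [NormedAddCommGroup E] [NormedSpace ℝ E]
    [NormedAddCommGroup F] [NormedSpace ℝ F] (h : HasPolyhedralErrorBound E) (f : E ≃L[ℝ] F) :
    HasPolyhedralErrorBound F := by
  intro C _ M b
  obtain ⟨K, hK, η, hη, H⟩ := h C (fun c => (M c).comp (f : E →L[ℝ] F)) b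
  refine ⟨‖(f : E →L[ℝ] F)‖ * K, by positivity, η, hη, fun ε h0 h1 u hu => ?_⟩
  obtain ⟨v, hv, huv⟩ := H ε h0 h1 (f.symm u) (by simpa using hu)
  refine ⟨f v, hv, ?_⟩
  calc ‖u - f v‖ = ‖(f : E →L[ℝ] F) (f.symm u - v)‖ := by simp
    _ ≤ ‖(f : E →L[ℝ] F)‖ * ‖f.symm u - v‖ := ContinuousLinearMap.le_opNorm _ _
    _ ≤ ‖(f : E →L[ℝ] F)‖ * (K * ε) := by gcongr
    _ = _ := by ring

/-- Hoffman's error bound, together with the closedness of the set of right-hand sides for which a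
system of linear inequalities is feasible. -/
theorem hasPolyhedralErrorBound (E : Type*) [NormedAddCommGroup E] [NormedSpace ℝ E]
    [FiniteDimensional ℝ E] : HasPolyhedralErrorBound E := by
  have key : ∀ n : ℕ, HasPolyhedralErrorBound (Fin n → ℝ) := by
    intro n
    induction n with
    | zero => exact .of_subsingleton _
    | succ n ih => exact ih.prod_real.congr (Fin.consEquivL ℝ fun _ : Fin (n + 1) => ℝ)
  exact (key (Module.finrank ℝ E)).congr (ContinuousLinearEquiv.ofFinrankEq (by simp))

/-- The local error bound for a system of linear inequalities together with linear equations. -/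
theorem exists_errorBound_le_eq {E F : Type*} [NormedAddCommGroup E] [NormedSpace ℝ E]
    [FiniteDimensional ℝ E] [NormedAddCommGroup F] [NormedSpace ℝ F] [FiniteDimensional ℝ F]
    {C : Type} [Fintype C] (M : C → E →L[ℝ] ℝ) (b : C → ℝ) (L : E →L[ℝ] F) (y : F) :
    ∃ K, 0 ≤ K ∧ ∃ η, 0 < η ∧ ∀ ε, 0 ≤ ε → ε ≤ η → ∀ u, (∀ c, M c u ≤ b c + ε) →
      ‖L u - y‖ ≤ ε → ∃ v, (∀ c, M c v ≤ b c) ∧ L v = y ∧ ‖u - v‖ ≤ K * ε := by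
  obtain ⟨e⟩ : Nonempty (F ≃L[ℝ] (Fin (Module.finrank ℝ F) → ℝ)) :=
    ⟨ContinuousLinearEquiv.ofFinrankEq (by simp)⟩
  let g : Fin (Module.finrank ℝ F) → E →L[ℝ] ℝ := fun i =>
    (ContinuousLinearMap.proj (R := ℝ) (φ := fun _ : Fin (Module.finrank ℝ F) => ℝ) i).comp
      ((e : F →L[ℝ] _).comp L)
  have hg : ∀ i u, g i u = e (L u) i := fun i u => rfl
  obtain ⟨B, hB1, hB⟩ : ∃ B : ℝ, 1 ≤ B ∧ ∀ z, ‖e z‖ ≤ B * ‖z‖ :=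
    ⟨max 1 ‖e.toContinuousLinearMap‖, le_max_left _ _, fun z =>
      (e.toContinuousLinearMap.le_opNorm z).trans (by gcongr; exact le_max_right _ _)⟩
  obtain ⟨K, hK, η, hη, H⟩ := hasPolyhedralErrorBound E
    (C ⊕ (Fin (Module.finrank ℝ F) ⊕ Fin (Module.finrank ℝ F)))
    (Sum.elim M (Sum.elim g (fun i => -g i)))
    (Sum.elim b (Sum.elim (fun i => e y i) (fun i => -e y i)))
  refine ⟨K * B, by positivity, η / B, by positivity, fun ε hε hεη u hu huL => ?_⟩
  have hεB : ε ≤ B * ε := by nlinarith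
  have hi : ∀ i, |g i u - e y i| ≤ B * ε := by
    intro i
    have h1 : g i u - e y i = e (L u - y) i := by rw [hg, map_sub]; rfl
    rw [h1, ← Real.norm_eq_abs]
    exact (norm_le_pi_norm _ i).trans ((hB _).trans (by gcongr))
  obtain ⟨v, hv, huv⟩ := H (B * ε) (by positivity)
    (by rw [le_div_iff₀ (by positivity)] at hεη; linarith) u (by
    rintro (c | i | i)
    · exact (hu c).trans (by simpa using hεB)
    · have := (abs_le.1 (hi i)).2
      simp only [Sum.elim_inr, Sum.elim_inl]; linarith
    · have := (abs_le.1 (hi i)).1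
      simp only [Sum.elim_inr, neg_apply]; linarith)
  refine ⟨v, fun c => hv (.inl c), e.injective (funext fun i => ?_), by linarith⟩
  have h1 := hv (.inr (.inl i))
  have h2 := hv (.inr (.inr i))
  simp only [Sum.elim_inr, Sum.elim_inl, neg_apply] at h1 h2
  rw [← hg]
  linarith

/-! ### Normal cones of polyhedra -/

section Normal

variable {E : Type*} [NormedAddCommGroup E] [InnerProductSpace ℝ E]

/-- The vector `w` belongs to the normal cone at `x` of the polyhedron `{y | ⟪a c, y⟫ ≤ b c}`,
expressed through multipliers: `x` is a point of the polyhedron and `w` a nonnegative combination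
of the normals of the constraints that are active at `x`. -/
def IsPolyhedralNormal {C : Type} [Fintype C] (a : C → E) (b : C → ℝ) (x w : E) : Prop :=
  (∀ c, inner ℝ (a c) x ≤ b c) ∧ ∃ m : C → ℝ, (∀ c, 0 ≤ m c) ∧
    (∀ c, m c = 0 ∨ inner ℝ (a c) x = b c) ∧ ∑ c, m c • a c = w

theorem IsPolyhedralNormal.inner_nonpos {C : Type} [Fintype C] {a : C → E} {b : C → ℝ} {x w : E}
    (h : IsPolyhedralNormal a b x w) {y : E} (hy : ∀ c, inner ℝ (a c) y ≤ b c) :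
    inner ℝ w (y - x) ≤ 0 := by
  obtain ⟨-, m, hm, hc, rfl⟩ := h
  rw [sum_inner]
  refine Finset.sum_nonpos fun c _ => ?_
  rw [inner_smul_left, inner_sub_right]
  rcases hc c with h | h
  · simp [h]
  · have := mul_nonneg (hm c) (sub_nonneg.2 (hy c))
    simp only [conj_trivial]
    rw [h]; linarith

theorem IsPolyhedralNormal.inner_sub_nonneg {C : Type} [Fintype C] {a : C → E} {b : C → ℝ}
    {x w x' w' : E} (h : IsPolyhedralNormal a b x w) (h' : IsPolyhedralNormal a b x' w') :
    0 ≤ inner ℝ (w - w') (x - x') := by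
  have h1 := h.inner_nonpos h'.1
  have h2 := h'.inner_nonpos h.1
  rw [← neg_sub x x', inner_neg_right] at h1
  rw [inner_sub_left]
  linarith

theorem IsPolyhedralNormal.smul {C : Type} [Fintype C] {a : C → E} {b : C → ℝ} {x w : E}
    (h : IsPolyhedralNormal a b x w) {r : ℝ} (hr : 0 ≤ r) : IsPolyhedralNormal a b x (r • w) := by
  obtain ⟨hx, m, hm, hc, rfl⟩ := h
  refine ⟨hx, fun c => r * m c, fun c => mul_nonneg hr (hm c), fun c => ?_, ?_⟩
  · rcases hc c with h | h <;> simp [h]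
  · simp [Finset.smul_sum, mul_smul]

/-- A finitely generated convex cone is closed: the generating coefficients of a nearby point solve
a system of linear inequalities up to a small error, so the exact system is feasible. -/
theorem isClosed_range_sum_nonneg_smul {C : Type} [Fintype C] [FiniteDimensional ℝ E]
    (a : C → E) : IsClosed {w : E | ∃ m : C → ℝ, (∀ c, 0 ≤ m c) ∧ ∑ c, m c • a c = w} := by
  rw [← isSeqClosed_iff_isClosed]
  intro w w₀ hw hlim
  obtain ⟨K, -, η, hη, H⟩ := exists_errorBound_le_eq (E := C → ℝ)
    (fun c => -ContinuousLinearMap.proj (R := ℝ) (φ := fun _ : C => ℝ) c) 0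
    (∑ c, (ContinuousLinearMap.proj (R := ℝ) (φ := fun _ : C => ℝ) c).smulRight (a c)) w₀
  obtain ⟨n, hn⟩ := (Metric.tendsto_nhds.1 hlim η hη).exists
  obtain ⟨m, hm, hmw⟩ := hw n
  obtain ⟨v, hv, hvw, -⟩ := H η hη.le le_rfl m
    (fun c => by have := hm c; simp; linarith)
    (by simpa [hmw, ← dist_eq_norm] using hn.le)
  exact ⟨v, fun c => by simpa using hv c, by simpa using hvw⟩

/-- Farkas' lemma: a linear functional that is maximal on a polyhedron at `x` is a nonnegative
combination of the active normals. -/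
theorem isPolyhedralNormal_of_forall {C : Type} [Fintype C] [FiniteDimensional ℝ E]
    {a : C → E} {b : C → ℝ} {x w : E} (hx : ∀ c, inner ℝ (a c) x ≤ b c)
    (h : ∀ y, (∀ c, inner ℝ (a c) y ≤ b c) → inner ℝ w (y - x) ≤ 0) :
    IsPolyhedralNormal a b x w := by
  classical
  -- Inactive constraints are given the zero normal, so that they do not contribute.
  set a' : C → E := fun c => if inner ℝ (a c) x = b c then a c else 0 with ha'
  let K : ProperCone ℝ E :=
    { carrier := {w : E | ∃ m : C → ℝ, (∀ c, 0 ≤ m c) ∧ ∑ c, m c • a' c = w}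
      add_mem' := by
        rintro _ _ ⟨m, hm, rfl⟩ ⟨m', hm', rfl⟩
        exact ⟨m + m', fun c => add_nonneg (hm c) (hm' c), by
          simp [add_smul, Finset.sum_add_distrib]⟩
      zero_mem' := ⟨0, by simp, by simp⟩
      smul_mem' := by
        rintro r _ ⟨m, hm, rfl⟩
        refine ⟨fun c => r.1 * m c, fun c => mul_nonneg r.2 (hm c), ?_⟩
        rw [Finset.smul_sum]
        exact Finset.sum_congr rfl fun c _ => mul_smul _ _ _
      isClosed' := isClosed_range_sum_nonneg_smul a' }
  by_cases hw : w ∈ K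
  · obtain ⟨m, hm, hmw⟩ := hw
    refine ⟨hx, fun c => if inner ℝ (a c) x = b c then m c else 0, fun c => ?_, fun c => ?_, ?_⟩
    · dsimp only; split_ifs
      exacts [hm c, le_rfl]
    · dsimp only; split_ifs with hc
      exacts [.inr hc, .inl rfl]
    · rw [← hmw]
      refine Finset.sum_congr rfl fun c _ => ?_
      simp only [ha']; split_ifs <;> simp
  exfalso
  obtain ⟨d, hd, hwd⟩ := K.hyperplane_separation' hw
  have hda : ∀ c, inner ℝ (a c) x = b c → 0 ≤ inner ℝ (a c) d := by
    intro c hc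
    refine hd (a c) ⟨Pi.single c 1, fun i => ?_, ?_⟩
    · by_cases hi : i = c
      · subst hi; simp
      · simp [Pi.single_eq_of_ne hi]
    · rw [Finset.sum_eq_single c (fun i _ hi => by simp [Pi.single_eq_of_ne hi]) (by simp)]
      simp [ha', hc]
  have hcont : Tendsto (fun r : ℝ => x - r • d) (𝓝[>] 0) (𝓝 x) := by
    have : Continuous fun r : ℝ => x - r • d := by fun_prop
    simpa using this.tendsto 0 |>.mono_left nhdsWithin_le_nhds
  have hfeas : ∀ c, ∀ᶠ r : ℝ in 𝓝[>] 0, inner ℝ (a c) (x - r • d) ≤ b c := by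
    intro c
    rcases (hx c).eq_or_lt with hc | hc
    · filter_upwards [self_mem_nhdsWithin] with r hr
      have := mul_nonneg (le_of_lt hr) (hda c hc)
      rw [inner_sub_right, inner_smul_right]; linarith
    · have hcont2 : Tendsto (fun r : ℝ => inner ℝ (a c) (x - r • d)) (𝓝[>] 0)
          (𝓝 (inner ℝ (a c) x)) := tendsto_const_nhds.inner hcont
      exact (hcont2.eventually_lt_const hc).mono fun _ => le_of_lt
  obtain ⟨r, hr, hr1⟩ := ((eventually_mem_nhdsWithin (a := (0 : ℝ)) (s := Set.Ioi 0)).and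
    (eventually_all.2 hfeas)).exists
  have := h _ hr1
  rw [sub_sub_cancel_left, inner_neg_right, inner_smul_right] at this
  nlinarith [Set.mem_Ioi.1 hr]

/-- The normal cone map of a polyhedron has a closed graph. -/
theorem IsPolyhedralNormal.of_tendsto {C : Type} [Fintype C] [FiniteDimensional ℝ E]
    {a : C → E} {b : C → ℝ} {x w : ℕ → E} {x₀ w₀ : E}
    (h : ∀ n, IsPolyhedralNormal a b (x n) (w n)) (hx : Tendsto x atTop (𝓝 x₀))
    (hw : Tendsto w atTop (𝓝 w₀)) : IsPolyhedralNormal a b x₀ w₀ :=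
  isPolyhedralNormal_of_forall
    (fun c => le_of_tendsto' (tendsto_const_nhds.inner hx) fun n => (h n).1 c)
    fun _ hy =>
      le_of_tendsto' (hw.inner (tendsto_const_nhds.sub hx)) fun n => (h n).inner_nonpos hy

/-- The first-order condition at a minimiser over a polyhedron. The additional constraint set `U` is
a neighbourhood of the minimiser, so it contributes no multipliers. -/
theorem isPolyhedralNormal_of_isMinOn {C : Type} [Fintype C] [FiniteDimensional ℝ E]
    {a : C → E} {b : C → ℝ} {U : Set E} {f : E → ℝ} {x w : E}
    (hx : ∀ c, inner ℝ (a c) x ≤ b c) (hU : U ∈ 𝓝 x) (hf : HasFDerivAt f (innerSL ℝ w) x)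
    (hmin : IsMinOn f ({y | ∀ c, inner ℝ (a c) y ≤ b c} ∩ U) x) :
    IsPolyhedralNormal a b x (-w) := by
  set S : Set E := {y | ∀ c, inner ℝ (a c) y ≤ b c} with hS
  have hconv : Convex ℝ S := by
    rw [hS, Set.ofPred_forall]
    exact convex_iInter fun c => convex_halfSpace_le (innerSL ℝ (a c)).toLinearMap.isLinear _
  have hloc : IsLocalMinOn f S x := by
    filter_upwards [self_mem_nhdsWithin, mem_nhdsWithin_of_mem_nhds hU] with y hy hyU
    exact hmin ⟨hy, hyU⟩
  refine isPolyhedralNormal_of_forall hx fun y hy => ?_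
  have := hloc.hasFDerivWithinAt_nonneg hf.hasFDerivWithinAt
    (sub_mem_posTangentConeAt_of_segment_subset (hconv.segment_subset hx hy))
  rw [innerSL_apply_apply] at this
  rw [inner_neg_left]
  linarith

theorem IsPolyhedralNormal.exists_add_of_sumElim {C D : Type} [Fintype C] [Fintype D]
    {a : C → E} {b : C → ℝ} {a' : D → E} {b' : D → ℝ} {x w : E}
    (h : IsPolyhedralNormal (Sum.elim a a') (Sum.elim b b') x w) :
    ∃ w₁ w₂, IsPolyhedralNormal a b x w₁ ∧ IsPolyhedralNormal a' b' x w₂ ∧ w₁ + w₂ = w := by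
  obtain ⟨hx, m, hm, hc, hw⟩ := h
  rw [Fintype.sum_sum_type] at hw
  exact ⟨_, _, ⟨fun c => hx (.inl c), fun c => m (.inl c), fun c => hm _, fun c => hc (.inl c), rfl⟩,
    ⟨fun d => hx (.inr d), fun d => m (.inr d), fun d => hm _, fun d => hc (.inr d), rfl⟩, hw⟩

/-- Local error bound for the stationarity system of a polyhedral program in which the values
`⟪σ j, x⟫` are prescribed: a point `x` with multipliers `m` that satisfy the system approximately,
but with exact nonnegativity and exactly vanishing multipliers off a set of nearly active
constraints, is close to an exact solution. For each of the finitely many possible sets of active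
constraints the system is linear. -/
theorem exists_stationary_near {J W : Type} [Fintype J] [Fintype W] [FiniteDimensional ℝ E]
    (σ : J → E) (s : J → ℝ) (A : W → E) (B : W → ℝ) (p : E) :
    ∃ K, 0 ≤ K ∧ ∃ η, 0 < η ∧ ∀ ε, 0 ≤ ε → ε ≤ η → ∀ (x : E) (m : W → ℝ),
      (∀ j, |inner ℝ (σ j) x - s j| ≤ ε) → (∀ w, inner ℝ (A w) x ≤ B w + ε) → (∀ w, 0 ≤ m w) →
      (∀ w, m w = 0 ∨ |inner ℝ (A w) x - B w| ≤ ε) → ‖∑ w, m w • A w - p‖ ≤ ε →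
      ∃ (x' : E) (m' : W → ℝ), (∀ j, inner ℝ (σ j) x' = s j) ∧ (∀ w, inner ℝ (A w) x' ≤ B w) ∧
        (∀ w, 0 ≤ m' w) ∧ (∀ w, m' w = 0 ∨ inner ℝ (A w) x' = B w) ∧ ∑ w, m' w • A w = p ∧
        ‖x - x'‖ ≤ K * ε ∧ ‖m - m'‖ ≤ K * ε := by
  classical
  let fst := ContinuousLinearMap.fst ℝ E (W → ℝ)
  let mul : W → E × (W → ℝ) →L[ℝ] ℝ := fun w =>
    (ContinuousLinearMap.proj (R := ℝ) (φ := fun _ : W => ℝ) w).comp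
      (ContinuousLinearMap.snd ℝ E (W → ℝ))
  have key : ∀ I : Finset W, ∃ K, 0 ≤ K ∧ ∃ η, 0 < η ∧ ∀ ε, 0 ≤ ε → ε ≤ η →
      ∀ (x : E) (m : W → ℝ),
      (∀ j, |inner ℝ (σ j) x - s j| ≤ ε) → (∀ w, inner ℝ (A w) x ≤ B w + ε) → (∀ w, 0 ≤ m w) →
      (∀ w ∉ I, m w = 0) → (∀ w ∈ I, |inner ℝ (A w) x - B w| ≤ ε) → ‖∑ w, m w • A w - p‖ ≤ ε →
      ∃ (x' : E) (m' : W → ℝ), (∀ j, inner ℝ (σ j) x' = s j) ∧ (∀ w, inner ℝ (A w) x' ≤ B w) ∧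
        (∀ w, 0 ≤ m' w) ∧ (∀ w, m' w = 0 ∨ inner ℝ (A w) x' = B w) ∧ ∑ w, m' w • A w = p ∧
        ‖x - x'‖ ≤ K * ε ∧ ‖m - m'‖ ≤ K * ε := by
    intro I
    obtain ⟨K, hK, η, hη, H⟩ := exists_errorBound_le_eq (E := E × (W → ℝ))
      (F := (J → ℝ) × (W → ℝ) × E)
      (Sum.elim (fun w => (innerSL ℝ (A w)).comp fst) (fun w => -mul w))
      (Sum.elim B 0)
      ((ContinuousLinearMap.pi fun j => (innerSL ℝ (σ j)).comp fst).prod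
        ((ContinuousLinearMap.pi fun w => if w ∈ I then (innerSL ℝ (A w)).comp fst else mul w).prod
          (∑ w, (mul w).smulRight (A w))))
      (s, fun w => if w ∈ I then B w else 0, p)
    refine ⟨K, hK, η, hη, fun ε hε hεη x m hs hA hm hI hI' hp => ?_⟩
    obtain ⟨⟨x', m'⟩, h1, h2, h3⟩ := H ε hε hεη (x, m) (by
        rintro (w | w)
        · simpa [fst] using hA w
        · have := hm w
          simp [mul]; linarith) (by
        rw [Prod.norm_def, Prod.norm_def]
        refine max_le ((pi_norm_le_iff_of_nonneg hε).2 fun j => ?_)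
          (max_le ((pi_norm_le_iff_of_nonneg hε).2 fun w => ?_) ?_)
        · simpa [fst] using hs j
        · by_cases hw : w ∈ I
          · simpa [fst, hw] using hI' w hw
          · simpa [mul, hw, hI w hw] using hε
        · simpa [mul] using hp)
    simp only [Prod.ext_iff, funext_iff] at h2
    obtain ⟨h4, h5, h6⟩ := h2
    refine ⟨x', m', fun j => by simpa [fst] using h4 j, fun w => by simpa [fst] using h1 (.inl w),
      fun w => by simpa [mul] using h1 (.inr w), fun w => ?_, by simpa [mul] using h6,
      (norm_fst_le _).trans h3, (norm_snd_le _).trans h3⟩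
    have := h5 w
    by_cases hw : w ∈ I
    · right; simpa [hw, fst] using this
    · left; simpa [hw, mul] using this
  choose K hK η hη H using key
  have hKI : ∀ I, K I ≤ ∑ I, K I := fun I =>
    Finset.single_le_sum (fun I _ => hK I) (Finset.mem_univ I)
  obtain ⟨I₀, hI₀⟩ := Finite.exists_min η
  refine ⟨∑ I, K I, Finset.sum_nonneg fun I _ => hK I, η I₀, hη I₀,
    fun ε hε hεη x m hs hA hm hc hp => ?_⟩
  obtain ⟨x', m', h1, h2, h3, h4, h5, h6, h7⟩ :=
    H {w | m w ≠ 0} ε hε (hεη.trans (hI₀ _)) x m hs hA hm (fun w hw => by simpa using hw)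
      (fun w hw => (hc w).resolve_left (by simpa using hw)) hp
  exact ⟨x', m', h1, h2, h3, h4, h5, h6.trans (by gcongr; exact hKI _),
    h7.trans (by gcongr; exact hKI _)⟩

end Normal

/-! ### Linear convergence of ADMM for a polyhedral convex program -/

/-- The data of the optimality conditions of the program "minimise `⟪q, x⟫ + ∑ j, G j ⟪σ j, x⟫`
over the intersection of the polyhedra `{x | ⟪a c, x⟫ ≤ b c}` and `{x | ⟪a' d, x⟫ ≤ b' d}`", where
`g j` is the derivative of the convex function `G j` of one variable. -/
structure PolyhedralProgram (E J C D : Type) where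
  /-- the linear part of the objective -/
  q : E
  /-- the directions in which the objective is curved -/
  σ : J → E
  /-- the derivatives of the curved parts -/
  g : J → ℝ → ℝ
  /-- normals of the first polyhedron -/
  a : C → E
  /-- right-hand sides of the first polyhedron -/
  b : C → ℝ
  /-- normals of the second polyhedron -/
  a' : D → E
  /-- right-hand sides of the second polyhedron -/
  b' : D → ℝ

namespace PolyhedralProgram

variable {E J C D : Type} [NormedAddCommGroup E] [InnerProductSpace ℝ E] [Fintype J]

/-- The gradient of the objective at a point with `⟪σ j, x⟫ = s j`. -/
def grad (p : PolyhedralProgram E J C D) (s : J → ℝ) : E :=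
  p.q + ∑ j, p.g j (s j) • p.σ j

theorem inner_grad_sub {p : PolyhedralProgram E J C D} (s t : J → ℝ) (x : E) :
    inner ℝ (p.grad s - p.grad t) x = ∑ j, (p.g j (s j) - p.g j (t j)) * inner ℝ (p.σ j) x := by
  simp only [grad, add_sub_add_left_eq_sub, ← Finset.sum_sub_distrib, ← sub_smul, sum_inner,
    inner_smul_left, conj_trivial]

variable [Fintype C] [Fintype D]

/-- `x` and the scaled dual variable `l` form a saddle point with `⟪σ j, x⟫ = s j`. With the values
`s` prescribed, these conditions are linear up to the choice of the active constraints. -/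
def IsSaddle (p : PolyhedralProgram E J C D) (ρ : ℝ) (s : J → ℝ) (x l : E) : Prop :=
  (∀ j, inner ℝ (p.σ j) x = s j) ∧
    IsPolyhedralNormal p.a p.b x (-(p.grad s + ρ • l)) ∧ IsPolyhedralNormal p.a' p.b' x l

/-- The optimality conditions of one ADMM iteration, from the split variable `y` and the scaled dual
variable `l` to `x'`, `y'` and `l'`. In the first condition `x' - y + l` is written as
`l' + (y' - y)`. -/
structure IsIter (p : PolyhedralProgram E J C D) (ρ : ℝ) (y l x' y' l' : E) : Prop where
  normal_left : IsPolyhedralNormal p.a p.b x'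
    (-(p.grad (fun j => inner ℝ (p.σ j) x') + ρ • (l' + (y' - y))))
  normal_right : IsPolyhedralNormal p.a' p.b' y' l'
  dual : l' = l + (x' - y')

variable {p : PolyhedralProgram E J C D} {ρ : ℝ} {s : J → ℝ} {κ : J → ℝ}

/-- Every saddle point is approached at each iteration, by an amount that bounds the residuals of
the iteration and the curvature gap. -/
theorem IsIter.fejer (hρ : 0 < ρ) {x l y₀ l₀ x₁ y₁ l₁ : E} (hS : p.IsSaddle ρ s x l)
    (h : p.IsIter ρ y₀ l₀ x₁ y₁ l₁) (h₀ : IsPolyhedralNormal p.a' p.b' y₀ l₀)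
    (hκ : ∀ j, κ j * (inner ℝ (p.σ j) x₁ - s j) ^ 2 ≤
      (p.g j (inner ℝ (p.σ j) x₁) - p.g j (s j)) * (inner ℝ (p.σ j) x₁ - s j)) :
    ‖y₁ - x‖ ^ 2 + ‖l₁ - l‖ ^ 2 + (‖y₁ - y₀‖ ^ 2 + ‖l₁ - l₀‖ ^ 2 +
      2 / ρ * ∑ j, κ j * (inner ℝ (p.σ j) x₁ - s j) ^ 2) ≤ ‖y₀ - x‖ ^ 2 + ‖l₀ - l‖ ^ 2 := by
  obtain ⟨hs, hS1, hS2⟩ := hS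
  have h1 := h.normal_left.inner_sub_nonneg hS1
  have h2 := h.normal_right.inner_sub_nonneg hS2
  have h3 := h.normal_right.inner_sub_nonneg h₀
  have h4 : ∑ j, κ j * (inner ℝ (p.σ j) x₁ - s j) ^ 2 ≤
      inner ℝ (p.grad (fun j => inner ℝ (p.σ j) x₁) - p.grad s) (x₁ - x) := by
    rw [inner_grad_sub]
    refine Finset.sum_le_sum fun j _ => ?_
    rw [inner_sub_right (p.σ j) x₁ x, hs]
    exact hκ j
  have h5 : -(p.grad (fun j => inner ℝ (p.σ j) x₁) + ρ • (l₁ + (y₁ - y₀))) - -(p.grad s + ρ • l) =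
      -(p.grad (fun j => inner ℝ (p.σ j) x₁) - p.grad s) - ρ • ((l₁ - l) + (y₁ - y₀)) := by
    module
  rw [h5, inner_sub_left, inner_neg_left, inner_smul_left, conj_trivial] at h1
  have h6 : x₁ - x = (y₁ - x) + (l₁ - l₀) := by rw [h.dual]; abel
  have h7 : inner ℝ ((l₁ - l) + (y₁ - y₀)) (x₁ - x) =
      inner ℝ (l₁ - l) (y₁ - x) + inner ℝ (l₁ - l) (l₁ - l₀) + inner ℝ (y₁ - y₀) (y₁ - x) +
        inner ℝ (y₁ - y₀) (l₁ - l₀) := by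
    rw [h6, inner_add_left, inner_add_right, inner_add_right]; ring
  have h8 : ‖y₀ - x‖ ^ 2 = ‖y₁ - x‖ ^ 2 - 2 * inner ℝ (y₁ - y₀) (y₁ - x) + ‖y₁ - y₀‖ ^ 2 := by
    rw [show y₀ - x = (y₁ - x) - (y₁ - y₀) by abel, norm_sub_sq_real, real_inner_comm]
  have h9 : ‖l₀ - l‖ ^ 2 = ‖l₁ - l‖ ^ 2 - 2 * inner ℝ (l₁ - l) (l₁ - l₀) + ‖l₁ - l₀‖ ^ 2 := by
    rw [show l₀ - l = (l₁ - l) - (l₁ - l₀) by abel, norm_sub_sq_real]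
  rw [real_inner_comm] at h3
  have h10 : ρ * inner ℝ ((l₁ - l) + (y₁ - y₀)) (x₁ - x) ≤
      -∑ j, κ j * (inner ℝ (p.σ j) x₁ - s j) ^ 2 := by linarith
  have h11 : inner ℝ ((l₁ - l) + (y₁ - y₀)) (x₁ - x) ≤
      -(1 / ρ * ∑ j, κ j * (inner ℝ (p.σ j) x₁ - s j) ^ 2) := by
    rw [one_div, ← div_eq_inv_mul, ← neg_div, le_div_iff₀ hρ]; linarith
  have h12 : 2 / ρ * ∑ j, κ j * (inner ℝ (p.σ j) x₁ - s j) ^ 2 =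
      2 * (1 / ρ * ∑ j, κ j * (inner ℝ (p.σ j) x₁ - s j) ^ 2) := by ring
  rw [h12, h8, h9]
  linarith

/-- The distance of an iterate to the set of saddle points is bounded by the residuals of the
iteration and the deviations of the `⟪σ j, x₁⟫` from their prescribed values, provided these are
small: the derivatives `g j` may then be frozen at the prescribed values, up to an error that is
itself of the order of the deviations. -/
theorem exists_saddle_near [FiniteDimensional ℝ E] (p : PolyhedralProgram E J C D) (hρ : 0 < ρ)
    (hLip : ∀ j, (fun t => p.g j t - p.g j (s j)) =O[𝓝 (s j)] fun t => t - s j) :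
    ∃ K, 0 ≤ K ∧ ∃ η, 0 < η ∧ ∀ ε, 0 ≤ ε → ε ≤ η → ∀ {y₀ l₀ x₁ y₁ l₁ : E},
      p.IsIter ρ y₀ l₀ x₁ y₁ l₁ → ‖y₁ - y₀‖ ≤ ε → ‖l₁ - l₀‖ ≤ ε →
      (∀ j, |inner ℝ (p.σ j) x₁ - s j| ≤ ε) →
      ∃ x l, p.IsSaddle ρ s x l ∧ ‖y₁ - x‖ ≤ K * ε ∧ ‖l₁ - l‖ ≤ K * ε := by
  have hL : ∃ L, 0 ≤ L ∧ ∃ η, 0 < η ∧ ∀ j t, |t - s j| ≤ η →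
      |p.g j t - p.g j (s j)| ≤ L * |t - s j| := by
    have : ∀ j, ∃ L, 0 ≤ L ∧ ∃ η, 0 < η ∧ ∀ t, |t - s j| ≤ η →
        |p.g j t - p.g j (s j)| ≤ L * |t - s j| := by
      intro j
      obtain ⟨L, hL, h⟩ := (hLip j).exists_nonneg
      obtain ⟨η, hη, h⟩ := Metric.eventually_nhds_iff.1 h.bound
      exact ⟨L, hL, η / 2, by positivity, fun t ht => h (by rw [Real.dist_eq]; linarith)⟩
    choose L hL η hη h using this
    obtain ⟨η', hη', hmin⟩ : ∃ η', 0 < η' ∧ ∀ j, η' ≤ η j := by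
      cases isEmpty_or_nonempty J
      · exact ⟨1, one_pos, fun j => isEmptyElim j⟩
      · obtain ⟨j, hj⟩ := Finite.exists_min η
        exact ⟨η j, hη j, hj⟩
    refine ⟨∑ j, L j, Finset.sum_nonneg fun j _ => hL j, η', hη', fun j t ht => ?_⟩
    refine (h j t (ht.trans (hmin j))).trans ?_
    gcongr
    exact Finset.single_le_sum (fun i _ => hL i) (Finset.mem_univ j)
  obtain ⟨L, hL0, η₁, hη₁, hL⟩ := hL
  obtain ⟨K, hK, η₂, hη₂, H⟩ := exists_stationary_near p.σ s (Sum.elim p.a p.a')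
    (Sum.elim p.b p.b') (-p.grad s)
  -- `B` bounds the errors that an iterate with residuals of size `ε` makes in each condition.
  set B : ℝ := 1 + ∑ d, ‖p.a' d‖ + (∑ j, L * ‖p.σ j‖ + ρ) with hB
  have hBσ : 0 ≤ ∑ j, L * ‖p.σ j‖ := Finset.sum_nonneg fun j _ => by positivity
  have hBa : 0 ≤ ∑ d, ‖p.a' d‖ := Finset.sum_nonneg fun j _ => by positivity
  have hB1 : 1 ≤ B := by linarith
  have hBd : ∀ d, ‖p.a' d‖ ≤ B := fun d => by
    have := Finset.single_le_sum (f := fun d => ‖p.a' d‖) (fun i _ => norm_nonneg _)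
      (Finset.mem_univ d)
    linarith
  refine ⟨1 + K * B + ρ⁻¹ * (∑ d, ‖p.a' d‖) * (K * B), by positivity, min η₁ (η₂ / B),
    by positivity, ?_⟩
  intro ε hε hεη y₀ l₀ x₁ y₁ l₁ h hy hl hσ
  have hε1 : ε ≤ η₁ := hεη.trans (min_le_left _ _)
  have hε2 : B * ε ≤ η₂ := by
    have := hεη.trans (min_le_right _ _)
    rw [le_div_iff₀ (by positivity)] at this; linarith
  have hεB : ε ≤ B * ε := by nlinarith
  have hxy : x₁ - y₁ = l₁ - l₀ := by rw [h.dual]; abel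
  obtain ⟨hx, m, hm, hmc, hmw⟩ := h.normal_left
  obtain ⟨hy', m', hm', hmc', hmw'⟩ := h.normal_right
  have ha' : ∀ d, |inner ℝ (p.a' d) x₁ - inner ℝ (p.a' d) y₁| ≤ B * ε := by
    intro d
    rw [← inner_sub_right, hxy]
    refine (abs_real_inner_le_norm _ _).trans ?_
    gcongr
    exact hBd d
  obtain ⟨x, n, h1, h2, h3, h4, h5, h6, h7⟩ := H (B * ε) (by positivity) hε2 x₁
    (Sum.elim m (ρ • m')) (fun j => (hσ j).trans hεB)
    (by
      rintro (c | d)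
      · have : 0 ≤ B * ε := by positivity
        have := hx c
        simp only [Sum.elim_inl]; linarith
      · have := (abs_le.1 (ha' d)).2
        have := hy' d
        simp only [Sum.elim_inr]; linarith)
    (by
      rintro (c | d)
      · exact hm c
      · exact mul_nonneg hρ.le (hm' d))
    (by
      rintro (c | d)
      · rcases hmc c with h | h
        · exact .inl h
        · right
          simp only [Sum.elim_inl, h, sub_self, abs_zero]; positivity
      · rcases hmc' d with h | h
        · left; simp [h]
        · right
          have := ha' d
          simp only [Sum.elim_inr]; rwa [h] at this)
    (by
      have e1 : ∑ w, (Sum.elim m (ρ • m') : C ⊕ D → ℝ) w • (Sum.elim p.a p.a' w : E) =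
          ∑ c, m c • p.a c + ρ • ∑ d, m' d • p.a' d := by
        simp [Fintype.sum_sum_type, Finset.smul_sum, mul_smul]
      have e2 : ∑ w, (Sum.elim m (ρ • m') : C ⊕ D → ℝ) w • (Sum.elim p.a p.a' w : E) - -p.grad s =
          -(∑ j, (p.g j (inner ℝ (p.σ j) x₁) - p.g j (s j)) • p.σ j) - ρ • (y₁ - y₀) := by
        rw [e1, hmw, hmw']
        simp only [grad, sub_smul, Finset.sum_sub_distrib]
        module
      rw [e2]
      calc _ ≤ ‖∑ j, (p.g j (inner ℝ (p.σ j) x₁) - p.g j (s j)) • p.σ j‖ + ‖ρ • (y₁ - y₀)‖ := by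
            rw [← norm_neg (∑ j, _)]; exact norm_sub_le _ _
        _ ≤ ∑ j, L * ‖p.σ j‖ * ε + ρ * ε := by
            refine add_le_add ((norm_sum_le _ _).trans (Finset.sum_le_sum fun j _ => ?_)) ?_
            · rw [norm_smul, Real.norm_eq_abs]
              calc _ ≤ (L * ε) * ‖p.σ j‖ := by
                    gcongr
                    exact (hL j _ ((hσ j).trans hε1)).trans (by gcongr; exact hσ j)
                _ = _ := by ring
            · rw [norm_smul, Real.norm_of_nonneg hρ.le]; gcongr
        _ = (∑ j, L * ‖p.σ j‖ + ρ) * ε := by rw [← Finset.sum_mul, add_mul]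
        _ ≤ B * ε := by gcongr; linarith)
  rw [Fintype.sum_sum_type] at h5
  simp only [Sum.elim_inl, Sum.elim_inr] at h5
  refine ⟨x, ρ⁻¹ • ∑ d, n (.inr d) • p.a' d, ⟨h1, ⟨fun c => h2 (.inl c), fun c => n (.inl c),
    fun c => h3 (.inl c), fun c => h4 (.inl c), ?_⟩, ?_⟩, ?_, ?_⟩
  · rw [smul_inv_smul₀ hρ.ne', neg_add, ← h5]; abel
  · exact IsPolyhedralNormal.smul ⟨fun d => h2 (.inr d), fun d => n (.inr d),
      fun d => h3 (.inr d), fun d => h4 (.inr d), rfl⟩ (inv_nonneg.2 hρ.le)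
  · have e : y₁ - x = (x₁ - x) - (l₁ - l₀) := by rw [← hxy]; abel
    have : 0 ≤ ρ⁻¹ * (∑ d, ‖p.a' d‖) * (K * B) * ε := by positivity
    calc ‖y₁ - x‖ ≤ ‖x₁ - x‖ + ‖l₁ - l₀‖ := by rw [e]; exact norm_sub_le _ _
      _ ≤ K * (B * ε) + ε := by gcongr
      _ ≤ _ := by linarith
  · have e : l₁ - ρ⁻¹ • ∑ d, n (.inr d) • p.a' d =
        ρ⁻¹ • ∑ d, (ρ * m' d - n (.inr d)) • p.a' d := by
      rw [← hmw']
      simp only [sub_smul, Finset.sum_sub_distrib, smul_sub, mul_smul, ← Finset.smul_sum]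
      rw [inv_smul_smul₀ hρ.ne']
    rw [e, norm_smul, Real.norm_of_nonneg (inv_nonneg.2 hρ.le)]
    have e1 : ‖∑ d, (ρ * m' d - n (.inr d)) • p.a' d‖ ≤ ∑ d, ‖p.a' d‖ * (K * (B * ε)) := by
      refine (norm_sum_le _ _).trans (Finset.sum_le_sum fun d _ => ?_)
      rw [norm_smul, mul_comm]
      gcongr
      exact (norm_le_pi_norm (Sum.elim m (ρ • m') - n) (.inr d)).trans h7
    rw [← Finset.sum_mul] at e1
    have : 0 ≤ (1 + K * B) * ε := by positivity
    calc _ ≤ ρ⁻¹ * ((∑ d, ‖p.a' d‖) * (K * (B * ε))) := by gcongr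
      _ ≤ _ := by linarith

/-- A nonnegative sequence whose decrements eventually dominate a fixed fraction of the next term
converges to zero linearly. -/
theorem _root_.exists_geometric_bound_of_decrement {V R : ℕ → ℝ} (hV : ∀ t, 0 ≤ V t)
    (hR : ∀ t, V (t + 1) + R t ≤ V t) {K : ℝ} (hK : 0 < K)
    (h : ∀ᶠ t in atTop, V (t + 1) ≤ K * R t) :
    ∃ A θ : ℝ, 0 ≤ A ∧ 0 < θ ∧ θ < 1 ∧ ∀ᶠ t in atTop, V t ≤ A * θ ^ t := by
  obtain ⟨T, hT⟩ := eventually_atTop.1 h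
  set θ : ℝ := K / (K + 1) with hθ
  have hθ0 : 0 < θ := by positivity
  have hθ1 : θ < 1 := by rw [hθ, div_lt_one (by positivity)]; linarith
  refine ⟨V T / θ ^ T, θ, div_nonneg (hV T) (by positivity), hθ0, hθ1,
    eventually_atTop.2 ⟨T, fun t ht => ?_⟩⟩
  induction t, ht using Nat.le_induction with
  | base => rw [div_mul_cancel₀ _ (by positivity)]
  | succ t ht ih =>
    have h1 := hT t ht
    have h2 := hR t
    have h3 : V (t + 1) ≤ θ * V t := by
      rw [hθ, div_mul_eq_mul_div, le_div_iff₀ (by positivity)]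
      nlinarith
    calc V (t + 1) ≤ θ * (V T / θ ^ T * θ ^ t) := h3.trans (by gcongr)
      _ = _ := by rw [pow_succ]; ring

/-- Linear convergence of ADMM to a saddle point. The squared distance to the set of saddle points
decreases by at least the squared residuals, which by the error bound control that distance. -/
theorem exists_linear_convergence [FiniteDimensional ℝ E] (p : PolyhedralProgram E J C D)
    (hρ : 0 < ρ) (hκ : ∀ j, 0 < κ j)
    (hLip : ∀ j, (fun t => p.g j t - p.g j (s j)) =O[𝓝 (s j)] fun t => t - s j)
    (hex : ∃ x l, p.IsSaddle ρ s x l) {x y l : ℕ → E}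
    (h₀ : IsPolyhedralNormal p.a' p.b' (y 0) (l 0))
    (h : ∀ t, p.IsIter ρ (y t) (l t) (x (t + 1)) (y (t + 1)) (l (t + 1)))
    (hmono : ∀ t j, κ j * (inner ℝ (p.σ j) (x (t + 1)) - s j) ^ 2 ≤
      (p.g j (inner ℝ (p.σ j) (x (t + 1))) - p.g j (s j)) *
        (inner ℝ (p.σ j) (x (t + 1)) - s j)) :
    ∃ (x₀ l₀ : E) (A θ : ℝ), p.IsSaddle ρ s x₀ l₀ ∧ 0 ≤ A ∧ 0 < θ ∧ θ < 1 ∧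
      ∀ᶠ t in atTop, ‖x (t + 1) - x₀‖ ≤ A * θ ^ t ∧ ‖y t - x₀‖ ≤ A * θ ^ t := by
  have hN : ∀ t, IsPolyhedralNormal p.a' p.b' (y t) (l t) := by
    rintro (_ | t)
    exacts [h₀, (h t).normal_right]
  let S : Set (E × E) := {z | p.IsSaddle ρ s z.1 z.2}
  obtain ⟨xs, ls, hs⟩ := hex
  have : Nonempty S := ⟨⟨(xs, ls), hs⟩⟩
  let V : ℕ → S → ℝ := fun t z => ‖y t - z.1.1‖ ^ 2 + ‖l t - z.1.2‖ ^ 2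
  let R : ℕ → ℝ := fun t => ‖y (t + 1) - y t‖ ^ 2 + ‖l (t + 1) - l t‖ ^ 2 +
    2 / ρ * ∑ j, κ j * (inner ℝ (p.σ j) (x (t + 1)) - s j) ^ 2
  have hVR : ∀ t z, V (t + 1) z + R t ≤ V t z := fun t z =>
    (h t).fejer hρ z.2 (hN t) (hmono t)
  have hsum0 : ∀ t j, 0 ≤ κ j * (inner ℝ (p.σ j) (x (t + 1)) - s j) ^ 2 := fun t j =>
    mul_nonneg (hκ j).le (sq_nonneg _)
  have hR0 : ∀ t, 0 ≤ R t := fun t => by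
    have := Finset.sum_nonneg fun j (_ : j ∈ Finset.univ) => hsum0 t j
    positivity
  have hV0 : ∀ t z, 0 ≤ V t z := fun t z => by positivity
  have hVanti : ∀ z, Antitone fun t => V t z := fun z =>
    antitone_nat_of_succ_le fun t => by linarith [hVR t z, hR0 t]
  -- The residuals are summable along any saddle point, so they vanish in the limit.
  have hRlim : Tendsto R atTop (𝓝 0) := by
    obtain ⟨z⟩ := this
    have h1 := tendsto_atTop_ciInf (hVanti z) ⟨0, by rintro _ ⟨t, rfl⟩; exact hV0 t z⟩
    have h2 := h1.sub (h1.comp (tendsto_add_atTop_nat 1))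
    rw [sub_self] at h2
    exact squeeze_zero hR0 (fun t => by have := hVR t z; simp only [Function.comp]; linarith) h2
  have hRy : ∀ t, ‖y (t + 1) - y t‖ ≤ √(R t) := fun t => by
    apply Real.le_sqrt_of_sq_le
    have := Finset.sum_nonneg fun j (_ : j ∈ Finset.univ) => hsum0 t j
    have : 0 ≤ ‖l (t + 1) - l t‖ ^ 2 +
      2 / ρ * ∑ j, κ j * (inner ℝ (p.σ j) (x (t + 1)) - s j) ^ 2 := by positivity
    simp only [R]; linarith
  have hRl : ∀ t, ‖l (t + 1) - l t‖ ≤ √(R t) := fun t => by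
    apply Real.le_sqrt_of_sq_le
    have := Finset.sum_nonneg fun j (_ : j ∈ Finset.univ) => hsum0 t j
    have : 0 ≤ ‖y (t + 1) - y t‖ ^ 2 +
      2 / ρ * ∑ j, κ j * (inner ℝ (p.σ j) (x (t + 1)) - s j) ^ 2 := by positivity
    simp only [R]; linarith
  set c : J → ℝ := fun j => √(ρ / (2 * κ j)) with hc
  have hRσ : ∀ t j, |inner ℝ (p.σ j) (x (t + 1)) - s j| ≤ c j * √(R t) := fun t j => by
    have hκj := hκ j
    rw [hc, ← Real.sqrt_mul (by positivity)]
    apply Real.abs_le_sqrt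
    have h1 := Finset.single_le_sum (fun j _ => hsum0 t j) (Finset.mem_univ j)
    have h2 : 2 / ρ * (κ j * (inner ℝ (p.σ j) (x (t + 1)) - s j) ^ 2) ≤ R t := by
      have : 0 ≤ ‖y (t + 1) - y t‖ ^ 2 + ‖l (t + 1) - l t‖ ^ 2 := by positivity
      have := mul_le_mul_of_nonneg_left h1 (by positivity : 0 ≤ 2 / ρ)
      simp only [R]; linarith
    calc _ = ρ / (2 * κ j) * (2 / ρ * (κ j * (inner ℝ (p.σ j) (x (t + 1)) - s j) ^ 2)) := by
          field_simp
      _ ≤ _ := by gcongr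
  have hc0 : ∀ j, 0 ≤ c j := fun j => Real.sqrt_nonneg _
  set B : ℝ := 1 + ∑ j, c j with hB
  have hBc : 0 ≤ ∑ j, c j := Finset.sum_nonneg fun j _ => hc0 j
  have hcB : ∀ j, c j ≤ B := fun j => by
    have := Finset.single_le_sum (fun i _ => hc0 i) (Finset.mem_univ j)
    linarith
  obtain ⟨K, hK, η, hη, H⟩ := p.exists_saddle_near hρ hLip
  let d : ℕ → ℝ := fun t => ⨅ z, V t z
  have hbdd : ∀ t, BddBelow (Set.range (V t)) := fun t => ⟨0, by rintro _ ⟨z, rfl⟩; exact hV0 t z⟩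
  have hd0 : ∀ t, 0 ≤ d t := fun t => le_ciInf (hV0 t)
  have hdR : ∀ t, d (t + 1) + R t ≤ d t := fun t => le_ciInf fun z =>
    (add_le_add_left (ciInf_le (hbdd _) z) _).trans (hVR t z)
  have hRsqrt : Tendsto (fun t => B * √(R t)) atTop (𝓝 0) := by
    simpa using (hRlim.sqrt.const_mul B)
  have hdK : ∀ᶠ t in atTop, d (t + 1) ≤ (2 * (K * B) ^ 2 + 1) * R t := by
    filter_upwards [hRsqrt.eventually_le_const hη] with t ht
    have hsq := Real.sqrt_nonneg (R t)
    have h1 : √(R t) ≤ B * √(R t) := by nlinarith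
    obtain ⟨x', l', hz, h2, h3⟩ := H (B * √(R t)) (by positivity) ht (h t)
      ((hRy t).trans h1) ((hRl t).trans h1)
      (fun j => (hRσ t j).trans (by gcongr; exact hcB j))
    have h4 : d (t + 1) ≤ ‖y (t + 1) - x'‖ ^ 2 + ‖l (t + 1) - l'‖ ^ 2 :=
      ciInf_le (hbdd (t + 1)) ⟨(x', l'), hz⟩
    have h5 : ‖y (t + 1) - x'‖ ^ 2 ≤ (K * (B * √(R t))) ^ 2 := by gcongr
    have h6 : ‖l (t + 1) - l'‖ ^ 2 ≤ (K * (B * √(R t))) ^ 2 := by gcongr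
    have h7 : (K * (B * √(R t))) ^ 2 = (K * B) ^ 2 * R t := by
      rw [← mul_assoc, mul_pow, Real.sq_sqrt (hR0 t)]
    have := hR0 t
    linarith
  obtain ⟨A, θ, hA, hθ0, hθ1, hθ⟩ :=
    exists_geometric_bound_of_decrement hd0 hdR (by positivity) hdK
  -- By Fejér monotonicity all later iterates stay close to a saddle point near the current one.
  have hclose : ∀ t s, t ≤ s → ‖y s - y t‖ ≤ 2 * √(d t) ∧ ‖l s - l t‖ ≤ 2 * √(d t) := by
    intro t s hts
    have key : ∀ z : S, ‖y s - y t‖ ^ 2 / 4 ≤ V t z ∧ ‖l s - l t‖ ^ 2 / 4 ≤ V t z := by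
      intro z
      have h1 : V s z ≤ V t z := hVanti z hts
      have h2 : ‖y s - y t‖ ≤ ‖y s - z.1.1‖ + ‖y t - z.1.1‖ := by
        rw [← sub_sub_sub_cancel_right (y s) (y t) z.1.1]; exact norm_sub_le _ _
      have h3 : ‖l s - l t‖ ≤ ‖l s - z.1.2‖ + ‖l t - z.1.2‖ := by
        rw [← sub_sub_sub_cancel_right (l s) (l t) z.1.2]; exact norm_sub_le _ _
      have h4 : ‖y s - y t‖ ^ 2 ≤ (‖y s - z.1.1‖ + ‖y t - z.1.1‖) ^ 2 := by gcongr
      have h5 : ‖l s - l t‖ ^ 2 ≤ (‖l s - z.1.2‖ + ‖l t - z.1.2‖) ^ 2 := by gcongr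
      simp only [V] at h1 ⊢
      constructor <;>
      nlinarith [sq_nonneg (‖y s - z.1.1‖ - ‖y t - z.1.1‖), sq_nonneg (‖l s - z.1.2‖ - ‖l t - z.1.2‖),
        sq_nonneg (‖y s - z.1.1‖), sq_nonneg (‖y t - z.1.1‖), sq_nonneg (‖l s - z.1.2‖),
        sq_nonneg (‖l t - z.1.2‖)]
    have h1 : ‖y s - y t‖ ^ 2 / 4 ≤ d t := le_ciInf fun z => (key z).1
    have h2 : ‖l s - l t‖ ^ 2 / 4 ≤ d t := le_ciInf fun z => (key z).2
    constructor
    · have := Real.le_sqrt_of_sq_le (x := ‖y s - y t‖ / 2) (y := d t) (by linarith)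
      linarith
    · have := Real.le_sqrt_of_sq_le (x := ‖l s - l t‖ / 2) (y := d t) (by linarith)
      linarith
  have hdlim : Tendsto d atTop (𝓝 0) := by
    refine squeeze_zero' (.of_forall hd0) hθ ?_
    simpa using (tendsto_pow_atTop_nhds_zero_of_lt_one hθ0.le hθ1).const_mul A
  have hdlim' : Tendsto (fun t => 4 * √(d t)) atTop (𝓝 0) := by simpa using hdlim.sqrt.const_mul 4
  obtain ⟨x₀, hx₀⟩ := cauchySeq_tendsto_of_complete
    (cauchySeq_of_le_tendsto_0 (s := y) (fun t => 4 * √(d t)) (fun n m t hn hm => by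
      refine (dist_triangle_right _ _ (y t)).trans ?_
      rw [dist_eq_norm, dist_eq_norm]
      linarith [(hclose t n hn).1, (hclose t m hm).1]) hdlim')
  obtain ⟨l₀, hl₀⟩ := cauchySeq_tendsto_of_complete
    (cauchySeq_of_le_tendsto_0 (s := l) (fun t => 4 * √(d t)) (fun n m t hn hm => by
      refine (dist_triangle_right _ _ (l t)).trans ?_
      rw [dist_eq_norm, dist_eq_norm]
      linarith [(hclose t n hn).2, (hclose t m hm).2]) hdlim')
  have hyd : ∀ t, ‖y t - x₀‖ ≤ 2 * √(d t) := fun t => by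
    rw [norm_sub_rev]
    exact le_of_tendsto (hx₀.sub_const (y t)).norm
      (eventually_atTop.2 ⟨t, fun n hn => (hclose t n hn).1⟩)
  have hx : ∀ t, x (t + 1) = y (t + 1) + (l (t + 1) - l t) := fun t => by
    rw [(h t).dual]; abel
  have hxd : ∀ t, ‖x (t + 1) - x₀‖ ≤ 6 * √(d t) := fun t => by
    have e : x (t + 1) - x₀ = (y t - x₀) + (y (t + 1) - y t) + (l (t + 1) - l t) := by
      rw [hx]; abel
    have h1 := (hclose t (t + 1) t.le_succ)
    have h2 := hyd t
    rw [e]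
    exact (norm_add₃_le).trans (by linarith [h1.1, h1.2])
  have hxlim : Tendsto (fun t => x (t + 1)) atTop (𝓝 x₀) := by
    rw [tendsto_iff_norm_sub_tendsto_zero]
    exact squeeze_zero (fun _ => norm_nonneg _) hxd (by simpa using hdlim.sqrt.const_mul 6)
  have hσlim : ∀ j, Tendsto (fun t => inner ℝ (p.σ j) (x (t + 1))) atTop (𝓝 (s j)) := fun j => by
    rw [tendsto_iff_norm_sub_tendsto_zero]
    exact squeeze_zero (fun _ => norm_nonneg _) (fun t => hRσ t j)
      (by simpa using hRlim.sqrt.const_mul (c j))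
  have hglim : ∀ j, Tendsto (fun t => p.g j (inner ℝ (p.σ j) (x (t + 1)))) atTop
      (𝓝 (p.g j (s j))) := fun j => by
    have h1 : Tendsto (fun t => t - s j) (𝓝 (s j)) (𝓝 0) := by
      have : Continuous fun t => t - s j := by fun_prop
      simpa using this.tendsto (s j)
    exact (tendsto_sub_nhds_zero_iff.1 ((hLip j).trans_tendsto h1)).comp (hσlim j)
  refine ⟨x₀, l₀, 6 * √A, √θ, ⟨fun j => tendsto_nhds_unique
    (tendsto_const_nhds.inner hxlim) (hσlim j), ?_, .of_tendsto hN hx₀ hl₀⟩, by positivity,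
    by positivity, by rwa [Real.sqrt_lt' one_pos, one_pow], ?_⟩
  · refine IsPolyhedralNormal.of_tendsto (fun t => (h t).normal_left) hxlim ?_
    have h1 : Tendsto (fun t => p.grad fun j => inner ℝ (p.σ j) (x (t + 1))) atTop
        (𝓝 (p.grad s)) :=
      tendsto_const_nhds.add (tendsto_finsetSum _ fun j _ => (hglim j).smul_const _)
    have h2 := (hl₀.comp (tendsto_add_atTop_nat 1)).add
      ((hx₀.comp (tendsto_add_atTop_nat 1)).sub hx₀)
    rw [sub_self, add_zero] at h2
    exact (h1.add (h2.const_smul ρ)).neg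
  · filter_upwards [hθ] with t ht
    have h1 : √(d t) ≤ √A * √θ ^ t := by
      refine Real.sqrt_le_iff.2 ⟨by positivity, ht.trans_eq ?_⟩
      rw [mul_pow, Real.sq_sqrt hA, ← pow_mul, mul_comm t, pow_mul, Real.sq_sqrt hθ0.le]
    have h2 := hyd t
    have h3 := hxd t
    have h4 := Real.sqrt_nonneg (d t)
    constructor <;> linarith

end PolyhedralProgram

/-! ### The M/M/1 delay as a function of the load -/

theorem delay_sub_delay_ge {w μ s t : ℝ} (hw : 0 ≤ w) (hμ : 0 ≤ μ) (hs : s < μ) (ht : t < μ) :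
    w * μ / (μ - s) ^ 2 * (t - s) ≤ w * (t / (μ - t)) - w * (s / (μ - s)) := by
  have hs' : 0 < μ - s := sub_pos.2 hs
  have ht' : 0 < μ - t := sub_pos.2 ht
  have h : w * (t / (μ - t)) - w * (s / (μ - s)) - w * μ / (μ - s) ^ 2 * (t - s) =
      w * μ * (t - s) ^ 2 / ((μ - t) * (μ - s) ^ 2) := by
    field_simp
    ring
  have : 0 ≤ w * μ * (t - s) ^ 2 / ((μ - t) * (μ - s) ^ 2) := by positivity
  linarith

/-- The derivative of the M/M/1 delay is strongly monotone. -/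
theorem delay_deriv_strong_mono {w μ s t : ℝ} (hw : 0 ≤ w) (hs0 : 0 ≤ s) (hs : s < μ) (ht0 : 0 ≤ t)
    (ht : t < μ) :
    2 * w / μ ^ 2 * (s - t) ^ 2 ≤ (w * μ / (μ - s) ^ 2 - w * μ / (μ - t) ^ 2) * (s - t) := by
  have hs' : 0 < μ - s := sub_pos.2 hs
  have ht' : 0 < μ - t := sub_pos.2 ht
  have hμ : 0 < μ := hs0.trans_lt hs
  have h : (w * μ / (μ - s) ^ 2 - w * μ / (μ - t) ^ 2) * (s - t) =
      w * μ * (s - t) ^ 2 * (1 / ((μ - s) * (μ - t) ^ 2) + 1 / ((μ - s) ^ 2 * (μ - t))) := by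
    field_simp
    ring
  have h1 : 1 / (μ * μ ^ 2) ≤ 1 / ((μ - s) * (μ - t) ^ 2) := by
    gcongr <;> linarith
  have h2 : 1 / (μ ^ 2 * μ) ≤ 1 / ((μ - s) ^ 2 * (μ - t)) := by
    gcongr <;> linarith
  rw [h]
  calc 2 * w / μ ^ 2 * (s - t) ^ 2 =
        w * μ * (s - t) ^ 2 * (1 / (μ * μ ^ 2) + 1 / (μ ^ 2 * μ)) := by field_simp; ring
    _ ≤ _ := by gcongr

theorem hasDerivAt_delay {w μ s : ℝ} (hs : s < μ) :
    HasDerivAt (fun t => w * (t / (μ - t))) (w * μ / (μ - s) ^ 2) s := by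
  have hs' : μ - s ≠ 0 := (sub_pos.2 hs).ne'
  refine (((hasDerivAt_id' s).div ((hasDerivAt_id' s).const_sub μ) hs').const_mul w).congr_deriv ?_
  ring

/-- Delays form a barrier at the boundary of the stability region, so the minimum over the stable
part of a compact set is attained. -/
theorem exists_isMinOn_add_sum_delay {X ι : Type*} [TopologicalSpace X] [Fintype ι] {K : Set X}
    (hK : IsCompact K) {ℓ : X → ℝ} {σ : ι → X → ℝ} {w μ : ι → ℝ} (hℓ : Continuous ℓ)
    (hσ : ∀ i, Continuous (σ i)) (hw : ∀ i, 0 < w i) (hμ : ∀ i, 0 < μ i)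
    (hσ0 : ∀ x ∈ K, ∀ i, 0 ≤ σ i x) (hne : ∃ x ∈ K, ∀ i, σ i x < μ i) :
    ∃ x ∈ K, (∀ i, σ i x < μ i) ∧
      IsMinOn (fun x => ℓ x + ∑ i, w i * (σ i x / (μ i - σ i x))) {x ∈ K | ∀ i, σ i x < μ i} x := by
  obtain ⟨x₀, hx₀, hx₀μ⟩ := hne
  set f : X → ℝ := fun x => ℓ x + ∑ i, w i * (σ i x / (μ i - σ i x)) with hf
  obtain ⟨z, hz, hzmin⟩ := hK.exists_isMinOn ⟨x₀, hx₀⟩ hℓ.continuousOn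
  -- On the sublevel set of `x₀` every delay is at most `c`, which bounds the load away from `μ i`.
  set c : ℝ := max 0 (f x₀ - ℓ z) with hc
  have hc0 : 0 ≤ c := le_max_left _ _
  have hlev : ∀ x ∈ K, (∀ i, σ i x < μ i) → f x ≤ f x₀ →
      ∀ i, σ i x ≤ c * μ i / (w i + c) := by
    intro x hx hxμ hfx i
    have h1 : ∀ i, 0 ≤ w i * (σ i x / (μ i - σ i x)) := fun i =>
      mul_nonneg (hw i).le (div_nonneg (hσ0 x hx i) (sub_pos.2 (hxμ i)).le)
    have h2 := Finset.single_le_sum (fun i _ => h1 i) (Finset.mem_univ i)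
    have h3 : ℓ z ≤ ℓ x := hzmin hx
    have h4 : w i * (σ i x / (μ i - σ i x)) ≤ c := by
      refine le_trans ?_ (le_max_right _ _)
      simp only [hf] at hfx ⊢
      linarith
    rw [← mul_div_assoc, div_le_iff₀ (sub_pos.2 (hxμ i))] at h4
    have := hw i
    rw [le_div_iff₀ (by positivity)]
    linarith
  have hlt : ∀ i, c * μ i / (w i + c) < μ i := fun i => by
    have := hw i
    have := hμ i
    rw [div_lt_iff₀ (by positivity)]
    nlinarith
  set K' : Set X := K ∩ ⋂ i, {x | σ i x ≤ c * μ i / (w i + c)} with hK'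
  have hK'c : IsCompact K' :=
    hK.inter_right (isClosed_iInter fun i => isClosed_le (hσ i) continuous_const)
  have hK'μ : ∀ x ∈ K', ∀ i, σ i x < μ i := fun x hx i =>
    (Set.mem_iInter.1 hx.2 i).trans_lt (hlt i)
  have hfc : ContinuousOn f K' :=
    hℓ.continuousOn.add (continuousOn_finsetSum _ fun i _ => continuousOn_const.mul
      ((hσ i).continuousOn.div (continuousOn_const.sub (hσ i).continuousOn)
        fun x hx => (sub_pos.2 (hK'μ x hx i)).ne'))
  have hmem : ∀ x ∈ K, (∀ i, σ i x < μ i) → f x ≤ f x₀ → x ∈ K' := fun x hx hxμ hfx =>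
    ⟨hx, Set.mem_iInter.2 (hlev x hx hxμ hfx)⟩
  have hx₀' := hmem x₀ hx₀ hx₀μ le_rfl
  obtain ⟨x, hx, hmin⟩ := hK'c.exists_isMinOn ⟨x₀, hx₀'⟩ hfc
  refine ⟨x, hx.1, hK'μ x hx, fun y hy => ?_⟩
  rcases le_total (f y) (f x₀) with h | h
  · exact hmin (hmem y hy.1 hy.2 h)
  · exact (hmin hx₀').trans h

/-- A separable function is minimal on a product of sets exactly when each of its summands is
minimal on the corresponding factor. -/
theorem forall_isMinOn_iff_isMinOn_sum {ι : Type*} [Fintype ι] {α : ι → Type*}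
    (f : ∀ i, α i → ℝ) (S : ∀ i, Set (α i)) (u : ∀ i, α i) :
    (∀ i, u i ∈ S i ∧ IsMinOn (f i) (S i) (u i)) ↔
      (∀ i, u i ∈ S i) ∧ IsMinOn (fun v : ∀ i, α i => ∑ i, f i (v i)) {v | ∀ i, v i ∈ S i} u := by
  classical
  refine ⟨fun h => ⟨fun i => (h i).1, fun v hv => by
    simp only [Set.mem_ofPred_eq]
    exact Finset.sum_le_sum fun i _ => (h i).2 (hv i)⟩,
    fun ⟨hu, hmin⟩ i => ⟨hu i, fun v hv => ?_⟩⟩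
  have hmem : ∀ k, Function.update u i v k ∈ S k := fun k => by
    by_cases hk : k = i
    · subst hk; simpa using hv
    · simpa [hk] using hu k
  have h : ∑ k, f k (u k) ≤ ∑ k, f k (Function.update u i v k) := hmin hmem
  have e : ∑ k ∈ Finset.univ.erase i, f k (Function.update u i v k) =
      ∑ k ∈ Finset.univ.erase i, f k (u k) :=
    Finset.sum_congr rfl fun k hk => by rw [Function.update_of_ne (Finset.ne_of_mem_erase hk)]
  rw [← Finset.add_sum_erase _ _ (Finset.mem_univ i),
    ← Finset.add_sum_erase _ (fun k => f k (Function.update u i v k)) (Finset.mem_univ i), e,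
    Function.update_self] at h
  exact le_of_add_le_add_right h

/-! ### The allocation problem as a polyhedral program -/

/-- Allocations as vectors of a Euclidean space. -/
noncomputable def allocEquiv (N : ℕ) : Alloc N ≃L[ℝ] EuclideanSpace ℝ (Fin N × Fin N) :=
  ((LinearEquiv.curry ℝ ℝ (Fin N) (Fin N)).symm.trans
    (WithLp.linearEquiv 2 ℝ (Fin N × Fin N → ℝ)).symm).toContinuousLinearEquiv

theorem allocEquiv_apply {N : ℕ} (x : Alloc N) (c : Fin N × Fin N) :
    allocEquiv N x c = x c.1 c.2 := rfl

theorem inner_allocEquiv {N : ℕ} (x y : Alloc N) :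
    inner ℝ (allocEquiv N x) (allocEquiv N y) = ∑ j, ∑ i, x j i * y j i := by
  simp [PiLp.inner_apply, allocEquiv_apply, Fintype.sum_prod_type, mul_comm]

theorem norm_allocEquiv_sq {N : ℕ} (x : Alloc N) :
    ‖allocEquiv N x‖ ^ 2 = ∑ j, ∑ i, x j i ^ 2 := by
  rw [← real_inner_self_eq_norm_sq, inner_allocEquiv]
  simp only [pow_two]

namespace FogSystem

variable {N : ℕ} (P : FogSystem N)

/-- The weight of the queueing delays in the objective. -/
noncomputable def weight : ℝ := 1 / ∑ i, P.arr i

theorem weight_nonneg : 0 ≤ P.weight :=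
  one_div_nonneg.2 (Finset.sum_nonneg fun i _ => (P.arr_pos i).le)

theorem weight_pos (i : Fin N) : 0 < P.weight :=
  one_div_pos.2 (Finset.sum_pos (fun j _ => P.arr_pos j) ⟨i, Finset.mem_univ i⟩)

theorem chi_nonneg (i : Fin N) : 0 ≤ P.chi i :=
  div_nonneg (mul_nonneg (P.wS_nonneg i) (P.pue_pos i).le) (sub_pos.2 (P.etaBar_gt i)).le

/-- The cooperative workload allocation problem as a polyhedral program. The curved directions are
the loads of the nodes; the first polyhedron describes the admissible service vectors up to the
stability condition, the second one is the coupling set. -/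
noncomputable def program : PolyhedralProgram (EuclideanSpace ℝ (Fin N × Fin N)) (Fin N)
    ((Fin N × Fin N) ⊕ (Fin N × Fin N) ⊕ Fin N) (Fin N) where
  q := allocEquiv N fun j i => P.weight * P.tau j i - P.tauC / P.arr j
  σ i := allocEquiv N fun _ k => if k = i then 1 else 0
  g i s := P.weight * P.mu i / (P.mu i - s) ^ 2
  a := Sum.elim (fun c => -EuclideanSpace.single c 1) (Sum.elim (fun c => EuclideanSpace.single c 1)
    fun i => allocEquiv N fun _ k => if k = i then 1 else 0)
  b := Sum.elim 0 (Sum.elim (fun c => P.arr c.1) P.chi)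
  a' j := allocEquiv N fun k _ => if k = j then 1 else 0
  b' := P.arr

theorem inner_program_σ (i : Fin N) (x : Alloc N) :
    inner ℝ (P.program.σ i) (allocEquiv N x) = ∑ k, x k i := by
  simp [program, inner_allocEquiv]

theorem inner_program_a' (j : Fin N) (x : Alloc N) :
    inner ℝ (P.program.a' j) (allocEquiv N x) = ∑ i, x j i := by
  simp only [program, inner_allocEquiv]
  rw [Finset.sum_comm]
  simp

theorem forall_inner_program_a (x : Alloc N) :
    (∀ c, inner ℝ (P.program.a c) (allocEquiv N x) ≤ P.program.b c) ↔
      ∀ i, (∀ k, 0 ≤ x k i ∧ x k i ≤ P.arr k) ∧ ∑ k, x k i ≤ P.chi i := by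
  have h : ∀ i, inner ℝ (allocEquiv N fun _ k => if k = i then 1 else 0) (allocEquiv N x) =
      ∑ k, x k i := P.inner_program_σ (x := x)
  simp only [program, Sum.forall, Sum.elim_inl, Sum.elim_inr, h, inner_neg_left,
    EuclideanSpace.inner_single_left, allocEquiv_apply, Prod.forall]
  constructor
  · rintro ⟨h1, h2, h3⟩ i
    exact ⟨fun k => ⟨by simpa using h1 k i, by simpa using h2 k i⟩, h3 i⟩
  · intro h
    exact ⟨fun k i => by simpa using ((h i).1 k).1, fun k i => by simpa using ((h i).1 k).2,
      fun i => (h i).2⟩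

theorem forall_inner_program_a' (x : Alloc N) :
    (∀ d, inner ℝ (P.program.a' d) (allocEquiv N x) ≤ P.program.b' d) ↔ x ∈ P.couplingSet :=
  forall_congr' fun j => by rw [inner_program_a']; rfl

theorem forall_mem_nodeSet (x : Alloc N) :
    (∀ i, (fun j => x j i) ∈ P.nodeSet i) ↔
      (∀ c, inner ℝ (P.program.a c) (allocEquiv N x) ≤ P.program.b c) ∧
        ∀ i, ∑ k, x k i < P.mu i := by
  rw [forall_inner_program_a, ← forall_and]
  exact forall_congr' fun i => and_assoc.symm

/-- The objective, up to an additive constant, in the form of a polyhedral program. -/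
noncomputable def cost (z : EuclideanSpace ℝ (Fin N × Fin N)) : ℝ :=
  inner ℝ P.program.q z + ∑ i, P.weight * (inner ℝ (P.program.σ i) z /
    (P.mu i - inner ℝ (P.program.σ i) z))

theorem totalResponse_eq (x : Alloc N) :
    P.totalResponse x = ∑ i, (P.tauU i + P.tauC) + P.cost (allocEquiv N x) := by
  rw [← P.sum_nodeCost, cost]
  simp only [inner_program_σ]
  rw [program, inner_allocEquiv, Finset.sum_comm, ← Finset.sum_add_distrib,
    ← Finset.sum_add_distrib]
  refine Finset.sum_congr rfl fun i _ => ?_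
  simp only [nodeCost, ← weight.eq_1, mul_add, sub_mul, Finset.sum_add_distrib,
    Finset.sum_sub_distrib, ← Finset.sum_mul, Finset.mul_sum, Finset.sum_div]
  simp only [div_eq_mul_inv, one_mul, Finset.sum_mul, Finset.mul_sum]
  have h1 : ∑ j, P.weight * (x j i * P.tau j i) = ∑ j, P.weight * P.tau j i * x j i :=
    Finset.sum_congr rfl fun j _ => by ring
  have h2 : ∑ j, x j i * (P.arr j)⁻¹ * P.tauC = ∑ j, P.tauC * (P.arr j)⁻¹ * x j i :=
    Finset.sum_congr rfl fun j _ => by ring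
  rw [h1, h2]
  ring

theorem hasFDerivAt_cost {z : EuclideanSpace ℝ (Fin N × Fin N)}
    (hz : ∀ i, inner ℝ (P.program.σ i) z < P.mu i) :
    HasFDerivAt P.cost
      (innerSL ℝ (P.program.grad fun i => inner ℝ (P.program.σ i) z)) z := by
  have h1 : ∀ i, HasFDerivAt (fun z => inner ℝ (P.program.σ i) z) (innerSL ℝ (P.program.σ i)) z :=
    fun i => (innerSL ℝ (P.program.σ i)).hasFDerivAt
  have h2 := (innerSL ℝ P.program.q).hasFDerivAt (x := z) |>.add
    (HasFDerivAt.fun_sum (u := Finset.univ) fun i _ =>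
      (hasDerivAt_delay (w := P.weight) (hz i)).comp_hasFDerivAt z (h1 i))
  refine h2.congr_fderiv ?_
  ext y
  simp [PolyhedralProgram.grad, program]

theorem cost_sub_cost_ge {y z : EuclideanSpace ℝ (Fin N × Fin N)}
    (hy : ∀ i, inner ℝ (P.program.σ i) y < P.mu i)
    (hz : ∀ i, inner ℝ (P.program.σ i) z < P.mu i) :
    inner ℝ (P.program.grad fun i => inner ℝ (P.program.σ i) z) (y - z) ≤ P.cost y - P.cost z := by
  simp only [PolyhedralProgram.grad, cost, inner_add_left, sum_inner, inner_smul_left,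
    conj_trivial, inner_sub_right, add_sub_add_comm, ← Finset.sum_sub_distrib]
  refine add_le_add le_rfl (Finset.sum_le_sum fun i _ => ?_)
  rw [← mul_sub]
  exact delay_sub_delay_ge P.weight_nonneg (P.mu_pos i).le (hz i) (hy i)

theorem isCompact_setOf_inner_program_a :
    IsCompact {x : Alloc N | ∀ c, inner ℝ (P.program.a c) (allocEquiv N x) ≤ P.program.b c} := by
  refine (isCompact_Icc (a := (0 : Alloc N)) (b := fun j _ => P.arr j)).of_isClosed_subset ?_ ?_
  · rw [Set.ofPred_forall]
    exact isClosed_iInter fun c => isClosed_le (by fun_prop) continuous_const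
  · intro x hx
    have := (P.forall_inner_program_a x).1 hx
    exact ⟨fun j i => ((this i).1 j).1, fun j i => ((this i).1 j).2⟩

theorem sum_col_nonneg {x : Alloc N}
    (hx : ∀ c, inner ℝ (P.program.a c) (allocEquiv N x) ≤ P.program.b c) (i : Fin N) :
    0 ≤ ∑ k, x k i :=
  Finset.sum_nonneg fun k _ => (((P.forall_inner_program_a x).1 hx i).1 k).1

theorem zero_mem_polyhedron :
    ∀ c, inner ℝ (P.program.a c) (allocEquiv N 0) ≤ P.program.b c :=
  (P.forall_inner_program_a 0).2 fun i =>
    ⟨fun k => ⟨le_rfl, (P.arr_pos k).le⟩, by simpa using P.chi_nonneg i⟩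

theorem zero_mem_couplingSet : (0 : Alloc N) ∈ P.couplingSet := fun j => by
  simpa using (P.arr_pos j).le

theorem isClosed_couplingSet : IsClosed P.couplingSet := by
  rw [couplingSet, Set.ofPred_forall]
  exact isClosed_iInter fun j => isClosed_le (by fun_prop) continuous_const

/-- Existence of a minimiser of the objective plus a continuous term over the stable part of a
closed set of allocations. -/
theorem exists_isMinOn_cost_add {T : Set (Alloc N)} (hT : IsClosed T) (h0 : (0 : Alloc N) ∈ T)
    {ℓ : Alloc N → ℝ} (hℓ : Continuous ℓ) :
    ∃ x ∈ T, (∀ i, (fun j => x j i) ∈ P.nodeSet i) ∧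
      IsMinOn (fun x => P.cost (allocEquiv N x) + ℓ x)
        {x ∈ T | ∀ i, (fun j => x j i) ∈ P.nodeSet i} x := by
  have hσ : ∀ i, Continuous fun x : Alloc N => ∑ k, x k i := fun i => by fun_prop
  obtain ⟨x, hx, hxμ, hmin⟩ := exists_isMinOn_add_sum_delay
    (P.isCompact_setOf_inner_program_a.inter_right hT)
    (ℓ := fun x => inner ℝ P.program.q (allocEquiv N x) + ℓ x)
    (w := fun _ => P.weight) (μ := P.mu) (by fun_prop) hσ P.weight_pos P.mu_pos
    (fun x hx i => P.sum_col_nonneg hx.1 i)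
    ⟨0, ⟨P.zero_mem_polyhedron, h0⟩, fun i => by simpa using P.mu_pos i⟩
  refine ⟨x, hx.2, (P.forall_mem_nodeSet x).2 ⟨hx.1, hxμ⟩, fun y hy => ?_⟩
  have hy' := (P.forall_mem_nodeSet y).1 hy.2
  have := hmin (show y ∈ _ from ⟨⟨hy'.1, hy.1⟩, hy'.2⟩)
  simp only [Set.mem_ofPred_eq, cost, inner_program_σ] at this ⊢
  linarith

/-! ### The optimality conditions of the ADMM iteration -/

theorem setOf_inner_program_σ_lt_mem_nhds {x : Alloc N} (hx : ∀ i, ∑ k, x k i < P.mu i) :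
    {z | ∀ i, inner ℝ (P.program.σ i) z < P.mu i} ∈ 𝓝 (allocEquiv N x) := by
  refine IsOpen.mem_nhds ?_ fun i => by rw [inner_program_σ]; exact hx i
  rw [Set.ofPred_forall]
  exact isOpen_iInter_of_finite fun i => isOpen_lt (by fun_prop) continuous_const

/-- The simultaneous update of all nodes is one minimisation over the product of the node sets. -/
theorem forall_node_update_iff (ρ : ℝ) (y l x : Alloc N) :
    (∀ i, (fun j => x j i) ∈ P.nodeSet i ∧ IsMinOn (fun v : Fin N → ℝ =>
        P.nodeCost i v + ρ / 2 * ∑ j, (v j - y j i + l j i) ^ 2) (P.nodeSet i) (fun j => x j i)) ↔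
      (∀ i, (fun j => x j i) ∈ P.nodeSet i) ∧
        IsMinOn (fun x => P.cost (allocEquiv N x) +
          ρ / 2 * ‖allocEquiv N x - allocEquiv N (y - l)‖ ^ 2)
          {x | ∀ i, (fun j => x j i) ∈ P.nodeSet i} x := by
  have e : ∀ x : Alloc N, ∑ i, (P.nodeCost i (fun j => x j i) +
      ρ / 2 * ∑ j, (x j i - y j i + l j i) ^ 2) = ∑ i, (P.tauU i + P.tauC) +
        (P.cost (allocEquiv N x) + ρ / 2 * ‖allocEquiv N x - allocEquiv N (y - l)‖ ^ 2) := by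
    intro x
    rw [Finset.sum_add_distrib, P.sum_nodeCost, totalResponse_eq, ← map_sub, norm_allocEquiv_sq,
      ← Finset.mul_sum, Finset.sum_comm, add_assoc]
    congr! 6 with j _ i _
    simp only [Pi.sub_apply]
    ring
  have h := forall_isMinOn_iff_isMinOn_sum
    (fun i (v : Fin N → ℝ) => P.nodeCost i v + ρ / 2 * ∑ j, (v j - y j i + l j i) ^ 2) P.nodeSet
    (fun i j => x j i)
  refine h.trans (and_congr_right fun _ => ⟨fun hm u hu => ?_, fun hm u hu => ?_⟩)
  · have := hm (show (fun i j => u j i) ∈ {v : Fin N → Fin N → ℝ | ∀ i, v i ∈ P.nodeSet i} from hu)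
    simp only [Set.mem_ofPred_eq, e] at this
    exact le_of_add_le_add_left this
  · have := hm (show (fun j i => u i j) ∈ {v : Alloc N | ∀ i, (fun j => v j i) ∈ P.nodeSet i}
      from hu)
    have := add_le_add_right this (∑ i, (P.tauU i + P.tauC))
    rwa [← e, ← e] at this

theorem coordinator_objective (ρ : ℝ) (x l y : Alloc N) :
    ρ / 2 * ∑ j, ∑ i, (x j i - y j i + l j i) ^ 2 =
      ρ / 2 * ‖allocEquiv N y - allocEquiv N (x + l)‖ ^ 2 := by
  rw [← map_sub, norm_allocEquiv_sq]
  congr 1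
  refine Finset.sum_congr rfl fun j _ => Finset.sum_congr rfl fun i _ => ?_
  simp only [Pi.sub_apply, Pi.add_apply]
  ring

theorem _root_.hasFDerivAt_half_norm_sub_sq {E : Type*} [NormedAddCommGroup E]
    [InnerProductSpace ℝ E] (ρ : ℝ) (c z : E) :
    HasFDerivAt (fun z => ρ / 2 * ‖z - c‖ ^ 2) (innerSL ℝ (ρ • (z - c))) z := by
  have h := (((hasFDerivAt_id (𝕜 := ℝ) z).sub_const c).norm_sq).const_mul (ρ / 2)
  refine h.congr_fderiv ?_
  ext y
  simp
  ring

theorem isPolyhedralNormal_of_isMinOn_node {ρ : ℝ} {c x : Alloc N}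
    (hx : ∀ i, (fun j => x j i) ∈ P.nodeSet i)
    (hmin : IsMinOn (fun x => P.cost (allocEquiv N x) +
      ρ / 2 * ‖allocEquiv N x - allocEquiv N c‖ ^ 2)
      {x | ∀ i, (fun j => x j i) ∈ P.nodeSet i} x) :
    IsPolyhedralNormal P.program.a P.program.b (allocEquiv N x)
      (-(P.program.grad (fun i => inner ℝ (P.program.σ i) (allocEquiv N x)) +
        ρ • (allocEquiv N x - allocEquiv N c))) := by
  obtain ⟨hx1, hx2⟩ := (P.forall_mem_nodeSet x).1 hx
  have hd := (P.hasFDerivAt_cost (z := allocEquiv N x)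
    (fun i => by rw [inner_program_σ]; exact hx2 i)).add
      (hasFDerivAt_half_norm_sub_sq ρ (allocEquiv N c) (allocEquiv N x))
  rw [← map_add] at hd
  refine isPolyhedralNormal_of_isMinOn hx1 (P.setOf_inner_program_σ_lt_mem_nhds hx2) hd ?_
  rintro y ⟨hy1, hy2⟩
  obtain ⟨y, rfl⟩ := (allocEquiv N).surjective y
  refine hmin ((P.forall_mem_nodeSet y).2 ⟨hy1, fun i => ?_⟩)
  rw [← inner_program_σ]; exact hy2 i

theorem isPolyhedralNormal_of_isMinOn_coupling {ρ : ℝ} (hρ : 0 < ρ) {c y : Alloc N}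
    (hy : y ∈ P.couplingSet)
    (hmin : IsMinOn (fun y => ρ / 2 * ‖allocEquiv N y - allocEquiv N c‖ ^ 2) P.couplingSet y) :
    IsPolyhedralNormal P.program.a' P.program.b' (allocEquiv N y)
      (allocEquiv N c - allocEquiv N y) := by
  have h := isPolyhedralNormal_of_isMinOn ((P.forall_inner_program_a' y).2 hy) univ_mem
    (hasFDerivAt_half_norm_sub_sq ρ (allocEquiv N c) (allocEquiv N y)) (by
      rintro u ⟨hu, -⟩
      obtain ⟨u, rfl⟩ := (allocEquiv N).surjective u
      exact hmin ((P.forall_inner_program_a' u).1 hu))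
  have h2 := h.smul (inv_nonneg.2 hρ.le)
  rwa [smul_neg, inv_smul_smul₀ hρ.ne', neg_sub] at h2

variable {P} in
theorem _root_.IsADMMStep.isIter {ρ : ℝ} (hρ : 0 < ρ) {z z' : ADMMState N}
    (h : IsADMMStep P ρ z z') :
    P.program.IsIter ρ (allocEquiv N z.psi) (allocEquiv N z.dual) (allocEquiv N z'.phi)
      (allocEquiv N z'.psi) (allocEquiv N z'.dual) := by
  have hdual : z'.dual = z.dual + (z'.phi - z'.psi) := by
    ext j i; exact h.dual_update j i
  obtain ⟨h1, h2⟩ := (P.forall_node_update_iff ρ z.psi z.dual z'.phi).1 h.node_update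
  obtain ⟨h3, h4⟩ := h.coordinator_update
  simp only [coordinator_objective] at h4
  refine ⟨?_, ?_, by rw [hdual, map_add, map_sub]⟩
  · convert P.isPolyhedralNormal_of_isMinOn_node h1 h2 using 4
    simp only [hdual, map_add, map_sub]
    abel
  · convert P.isPolyhedralNormal_of_isMinOn_coupling hρ h3 h4 using 1
    simp only [hdual, map_add, map_sub]
    abel

theorem exists_isADMMStep {ρ : ℝ} (hρ : 0 < ρ) (z : ADMMState N) : ∃ z', IsADMMStep P ρ z z' := by
  obtain ⟨x, -, hx, hmin⟩ := P.exists_isMinOn_cost_add isClosed_univ (Set.mem_univ _)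
    (ℓ := fun x => ρ / 2 * ‖allocEquiv N x - allocEquiv N (z.psi - z.dual)‖ ^ 2) (by fun_prop)
  simp only [Set.mem_univ, true_and] at hmin
  have hclosed : IsClosed (allocEquiv N '' P.couplingSet) :=
    (allocEquiv N).toHomeomorph.isClosedMap _ P.isClosed_couplingSet
  obtain ⟨_, ⟨y, hy, rfl⟩, hdist⟩ := hclosed.exists_infDist_eq_dist
    ⟨_, Set.mem_image_of_mem _ P.zero_mem_couplingSet⟩ (allocEquiv N (x + z.dual))
  refine ⟨⟨x, y, z.dual + (x - y)⟩, (P.forall_node_update_iff ρ z.psi z.dual x).2 ⟨hx, hmin⟩,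
    ⟨hy, fun u hu => ?_⟩, fun j i => rfl⟩
  simp only [Set.mem_ofPred_eq, coordinator_objective]
  have : ‖allocEquiv N y - allocEquiv N (x + z.dual)‖ ≤
      ‖allocEquiv N u - allocEquiv N (x + z.dual)‖ := by
    rw [← dist_eq_norm, ← dist_eq_norm, dist_comm, ← hdist, dist_comm]
    exact Metric.infDist_le_dist_of_mem (Set.mem_image_of_mem _ hu)
  gcongr

variable {P} in
theorem inner_grad_sub_nonneg {x y : Alloc N} (hx : ∀ i, (fun j => x j i) ∈ P.nodeSet i)
    (hy : ∀ i, (fun j => y j i) ∈ P.nodeSet i) :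
    0 ≤ inner ℝ (P.program.grad (fun i => inner ℝ (P.program.σ i) (allocEquiv N x)) -
      P.program.grad (fun i => inner ℝ (P.program.σ i) (allocEquiv N y)))
        (allocEquiv N x - allocEquiv N y) := by
  rw [PolyhedralProgram.inner_grad_sub]
  refine Finset.sum_nonneg fun i _ => ?_
  rw [inner_sub_right]
  simp only [inner_program_σ]
  refine le_trans ?_ (delay_deriv_strong_mono P.weight_nonneg
    (Finset.sum_nonneg fun k _ => ((hx i).1 k).1) (hx i).2.2
    (Finset.sum_nonneg fun k _ => ((hy i).1 k).1) (hy i).2.2)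
  have := P.weight_nonneg
  positivity

variable {P} in
theorem _root_.IsADMMStep.unique {ρ : ℝ} (hρ : 0 < ρ) {z z₁ z₂ : ADMMState N}
    (h₁ : IsADMMStep P ρ z z₁) (h₂ : IsADMMStep P ρ z z₂) : z₁ = z₂ := by
  have hphi : z₁.phi = z₂.phi := by
    obtain ⟨hx1, hm1⟩ := (P.forall_node_update_iff ρ z.psi z.dual _).1 h₁.node_update
    obtain ⟨hx2, hm2⟩ := (P.forall_node_update_iff ρ z.psi z.dual _).1 h₂.node_update
    have h := (P.isPolyhedralNormal_of_isMinOn_node hx1 hm1).inner_sub_nonneg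
      (P.isPolyhedralNormal_of_isMinOn_node hx2 hm2)
    have hg := inner_grad_sub_nonneg hx1 hx2
    set u := allocEquiv N z₁.phi
    set v := allocEquiv N z₂.phi
    set gu := P.program.grad fun i => inner ℝ (P.program.σ i) u
    set gv := P.program.grad fun i => inner ℝ (P.program.σ i) v
    set c := allocEquiv N (z.psi - z.dual)
    have e : -(gu + ρ • (u - c)) - -(gv + ρ • (v - c)) = -(gu - gv) - ρ • (u - v) := by module
    rw [e, inner_sub_left, inner_neg_left, inner_smul_left, real_inner_self_eq_norm_sq,
      conj_trivial] at h
    have h0 : ‖u - v‖ ^ 2 ≤ 0 := by nlinarith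
    have h1 : ‖u - v‖ = 0 := by nlinarith [norm_nonneg (u - v)]
    exact (allocEquiv N).injective (sub_eq_zero.1 (norm_eq_zero.1 h1))
  have hpsi : z₁.psi = z₂.psi := by
    obtain ⟨hy1, hm1⟩ := h₁.coordinator_update
    obtain ⟨hy2, hm2⟩ := h₂.coordinator_update
    simp only [coordinator_objective, hphi] at hm1 hm2
    have h := (P.isPolyhedralNormal_of_isMinOn_coupling hρ hy1 hm1).inner_sub_nonneg
      (P.isPolyhedralNormal_of_isMinOn_coupling hρ hy2 hm2)
    rw [sub_sub_sub_cancel_left, ← neg_sub (allocEquiv N z₁.psi), inner_neg_left,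
      real_inner_self_eq_norm_sq] at h
    have h1 : ‖allocEquiv N z₁.psi - allocEquiv N z₂.psi‖ = 0 := by
      nlinarith [norm_nonneg (allocEquiv N z₁.psi - allocEquiv N z₂.psi)]
    exact (allocEquiv N).injective (sub_eq_zero.1 (norm_eq_zero.1 h1))
  have hdual : z₁.dual = z₂.dual := by
    ext j i
    rw [h₁.dual_update, h₂.dual_update, hphi, hpsi]
  cases z₁
  cases z₂
  simp_all

theorem existsUnique_isADMMRun {ρ : ℝ} (hρ : 0 < ρ) (z₀ : ADMMState N) :
    ∃! z : ℕ → ADMMState N, z 0 = z₀ ∧ IsADMMRun P ρ z := by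
  choose step hstep using P.exists_isADMMStep hρ
  refine ⟨fun t => step^[t] z₀, ⟨rfl, fun t => ?_⟩, fun z ⟨h0, hz⟩ => funext fun t => ?_⟩
  · simp only [Function.iterate_succ_apply']
    exact hstep _
  · induction t with
    | zero => exact h0
    | succ t ih =>
      rw [Function.iterate_succ_apply', ← ih]
      exact (hz t).unique hρ (hstep _)

/-! ### Saddle points and optimal allocations -/

/-- An optimal allocation and its multipliers form a saddle point. -/
theorem exists_isSaddle {ρ : ℝ} (hρ : 0 < ρ) :
    ∃ (x : Alloc N) (l : EuclideanSpace ℝ (Fin N × Fin N)),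
      (∀ i, (fun j => x j i) ∈ P.nodeSet i) ∧
        P.program.IsSaddle ρ (fun i => ∑ k, x k i) (allocEquiv N x) l := by
  obtain ⟨x, hxc, hx, hmin⟩ := P.exists_isMinOn_cost_add P.isClosed_couplingSet P.zero_mem_couplingSet
    (ℓ := 0) continuous_const
  simp only [Pi.zero_apply, add_zero] at hmin
  obtain ⟨hx1, hx2⟩ := (P.forall_mem_nodeSet x).1 hx
  have hd := P.hasFDerivAt_cost (z := allocEquiv N x)
    (fun i => by rw [inner_program_σ]; exact hx2 i)
  have hxa' := (P.forall_inner_program_a' x).2 hxc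
  obtain ⟨w₁, w₂, h1, h2, hw⟩ := (isPolyhedralNormal_of_isMinOn
    (a := Sum.elim P.program.a P.program.a') (b := Sum.elim P.program.b P.program.b')
    (by rintro (c | d); exacts [hx1 c, hxa' d]) (P.setOf_inner_program_σ_lt_mem_nhds hx2) hd (by
      rintro y ⟨hy1, hy2⟩
      obtain ⟨y, rfl⟩ := (allocEquiv N).surjective y
      refine hmin ⟨(P.forall_inner_program_a' y).1 fun d => hy1 (.inr d),
        (P.forall_mem_nodeSet y).2 ⟨fun c => hy1 (.inl c), fun i => ?_⟩⟩
      rw [← inner_program_σ]; exact hy2 i)).exists_add_of_sumElim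
  simp only [inner_program_σ] at hw
  refine ⟨x, ρ⁻¹ • w₂, hx, fun i => P.inner_program_σ i x, ?_, h2.smul (inv_nonneg.2 hρ.le)⟩
  rw [smul_inv_smul₀ hρ.ne', neg_add, ← hw, add_neg_cancel_right]
  exact h1

variable {P} in
theorem isOptimal_of_isSaddle {ρ : ℝ} (hρ : 0 < ρ) {s : Fin N → ℝ} {x : Alloc N}
    {l : EuclideanSpace ℝ (Fin N × Fin N)} (hs : ∀ i, s i < P.mu i)
    (h : P.program.IsSaddle ρ s (allocEquiv N x) l) : P.IsOptimal x := by
  obtain ⟨h1, h2, h3⟩ := h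
  have hxs : (fun i => inner ℝ (P.program.σ i) (allocEquiv N x)) = s := funext h1
  have hxμ : ∀ i, inner ℝ (P.program.σ i) (allocEquiv N x) < P.mu i := fun i => by
    rw [h1]; exact hs i
  refine ⟨⟨(P.forall_mem_nodeSet x).2 ⟨h2.1, fun i => ?_⟩, (P.forall_inner_program_a' x).1 h3.1⟩,
    fun y ⟨hy, hyc⟩ => ?_⟩
  · rw [← inner_program_σ]; exact hxμ i
  obtain ⟨hy1, hy2⟩ := (P.forall_mem_nodeSet y).1 hy
  have h4 := P.cost_sub_cost_ge (y := allocEquiv N y)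
    (fun i => by rw [inner_program_σ]; exact hy2 i) hxμ
  have h5 := h2.inner_nonpos hy1
  have h6 := h3.inner_nonpos ((P.forall_inner_program_a' y).2 hyc)
  rw [hxs] at h4
  rw [inner_neg_left, inner_add_left, inner_smul_left, conj_trivial] at h5
  have h7 := mul_nonneg_of_nonpos_of_nonpos (neg_nonpos.2 hρ.le) h6
  simp only [Set.mem_ofPred_eq, totalResponse_eq]
  linarith

end FogSystem

theorem isBigO_geometric_one_div {θ : ℝ} (h0 : 0 < θ) (h1 : θ < 1) :
    (fun t : ℕ => θ ^ t) =O[atTop] fun t : ℕ => 1 / (t : ℝ) := by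
  refine IsBigO.of_bound 1 ?_
  filter_upwards [(tendsto_self_mul_const_pow_of_lt_one h0.le h1).eventually_le_const one_pos,
    eventually_gt_atTop 0] with t ht ht0
  have : (0 : ℝ) < t := by exact_mod_cast ht0
  rw [Real.norm_of_nonneg (by positivity), Real.norm_of_nonneg (by positivity), one_mul,
    le_div_iff₀ this, mul_comm]
  exact ht

/-- Every initialisation starts exactly one run, and every run converges to a global optimal
solution, at rate `O(1/t)` both in the iterates and in the objective value. -/
theorem theorem2 {N : ℕ} (P : FogSystem N) (ρ : ℝ) (hρ : 0 < ρ) :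
    (∀ z₀ : ADMMState N, ∃! z : ℕ → ADMMState N, z 0 = z₀ ∧ IsADMMRun P ρ z) ∧
    ∀ z : ℕ → ADMMState N, IsADMMRun P ρ z →
      ∃ xopt : Alloc N, P.IsOptimal xopt ∧
        Tendsto (fun t => (z t).phi) atTop (𝓝 xopt) ∧
        Tendsto (fun t => (z t).psi) atTop (𝓝 xopt) ∧
        (fun t : ℕ => (z t).phi - xopt) =O[atTop] (fun t : ℕ => 1 / (t : ℝ)) ∧
        (fun t : ℕ => P.totalResponse (z t).phi - P.totalResponse xopt)
          =O[atTop] (fun t : ℕ => 1 / (t : ℝ)) := by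
  refine ⟨P.existsUnique_isADMMRun hρ, fun z hz => ?_⟩
  obtain ⟨xs, ls, hxs, hsaddle⟩ := P.exists_isSaddle hρ
  have hs : ∀ i, ∑ k, xs k i < P.mu i := fun i => (hxs i).2.2
  obtain ⟨x₀, l₀, A, θ, hx₀, hA, hθ0, hθ1, hlin⟩ := P.program.exists_linear_convergence
    (κ := fun i => 2 * P.weight / P.mu i ^ 2) hρ
    (fun i => by have := P.weight_pos i; have := P.mu_pos i; positivity)
    (fun i => by
      have hμ : P.mu i - ∑ k, xs k i ≠ 0 := (sub_pos.2 (hs i)).ne'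
      have : DifferentiableAt ℝ (P.program.g i) (∑ k, xs k i) := by
        unfold FogSystem.program
        fun_prop (disch := positivity)
      exact this.hasFDerivAt.isBigO_sub)
    ⟨_, _, hsaddle⟩
    -- The dual variable is a normal of the coupling set only from the first iteration on.
    (x := fun t => allocEquiv N (z (t + 1)).phi) (y := fun t => allocEquiv N (z (t + 1)).psi)
    (l := fun t => allocEquiv N (z (t + 1)).dual) ((hz 0).isIter hρ).normal_right
    (fun t => (hz (t + 1)).isIter hρ)
    (fun t i => by
      have h := ((hz (t + 1)).node_update i).1
      rw [P.inner_program_σ]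
      exact delay_deriv_strong_mono P.weight_nonneg
        (Finset.sum_nonneg fun k _ => (h.1 k).1) h.2.2
        (Finset.sum_nonneg fun k _ => ((hxs i).1 k).1) (hs i))
  obtain ⟨xopt, rfl⟩ := (allocEquiv N).surjective x₀
  obtain ⟨T, hT⟩ := eventually_atTop.1 hlin
  have hphi : (fun t => allocEquiv N (z t).phi - allocEquiv N xopt) =O[atTop] fun t => θ ^ t := by
    refine IsBigO.of_bound (A / θ ^ 2) ?_
    filter_upwards [eventually_ge_atTop (T + 2)] with t ht
    obtain ⟨t, rfl⟩ := Nat.exists_eq_add_of_le' (le_of_add_le_right ht)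
    refine (hT t (by omega)).1.trans_eq ?_
    rw [Real.norm_of_nonneg (by positivity)]
    field_simp
    ring
  have hpsi : (fun t => allocEquiv N (z t).psi - allocEquiv N xopt) =O[atTop] fun t => θ ^ t := by
    refine IsBigO.of_bound (A / θ) ?_
    filter_upwards [eventually_ge_atTop (T + 1)] with t ht
    obtain ⟨t, rfl⟩ := Nat.exists_eq_add_of_le' (le_of_add_le_right ht)
    refine (hT t (by omega)).2.trans_eq ?_
    rw [Real.norm_of_nonneg (by positivity)]
    field_simp
    ring
  have hθ := tendsto_pow_atTop_nhds_zero_of_lt_one hθ0.le hθ1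
  have hphi_lim : Tendsto (fun t => allocEquiv N (z t).phi) atTop (𝓝 (allocEquiv N xopt)) :=
    tendsto_sub_nhds_zero_iff.1 (hphi.trans_tendsto hθ)
  have hpsi_lim : Tendsto (fun t => allocEquiv N (z t).psi) atTop (𝓝 (allocEquiv N xopt)) :=
    tendsto_sub_nhds_zero_iff.1 (hpsi.trans_tendsto hθ)
  have hrate := hphi.trans (isBigO_geometric_one_div hθ0 hθ1)
  have hx₀μ : ∀ i, inner ℝ (P.program.σ i) (allocEquiv N xopt) < P.mu i := fun i => by
    rw [hx₀.1]; exact hs i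
  refine ⟨xopt, FogSystem.isOptimal_of_isSaddle hρ hs hx₀,
    (allocEquiv N).toHomeomorph.isInducing.tendsto_nhds_iff.2 hphi_lim,
    (allocEquiv N).toHomeomorph.isInducing.tendsto_nhds_iff.2 hpsi_lim, ?_, ?_⟩
  · have := ((allocEquiv N).symm.toContinuousLinearMap.isBigO_comp
      (fun t => allocEquiv N (z t).phi - allocEquiv N xopt) atTop).trans hrate
    simpa using this
  · simp only [FogSystem.totalResponse_eq, add_sub_add_left_eq_sub]
    exact ((P.hasFDerivAt_cost hx₀μ).isBigO_sub.comp_tendsto hphi_lim).trans hrate
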